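/- For a finite simple graph $G=(V,E)$ let $\mu(G)$ be the size of a maximum matching of $G$. For integers $\beta\ge\beta^-\ge 0$, a subgraph $H=(V,E_H)$ of $G$ is an $\mathrm{EDCS}(G,\beta,\beta^-)$ if $\deg_H(u)+\deg_H(v)\le\beta$ for every edge $uv\in E_H$ and $\deg_H(u)+\deg_H(v)\ge\beta^-$ for every edge $uv\in E\setminus E_H$. For $p\in(0,1]$ let $G_p$ be the random subgraph of $G$ that keeps each edge of $G$ independently with probability $p$, and for a subgraph $H$ of $G$ let $H_p=H\cap G_p$. There are absolute constants $c,C>0$ and a deterministic polynomial-time algorithm with the following property. Given a finite graph $G$ and parameters $0<\varepsilon<1/4$ and $0<p\le 1$, the algorithm computes a subgraph $H$ of $G$ that is an $\mathrm{EDCS}(G,\beta,\beta-1)$, where $\beta$ is a positive integer that depends only on the two parameters as given to the algorithm, with $$c\cdot\frac{\log(1/(\varepsilon p))}{\varepsilon^2p}\;\le\;\beta\;\le\;C\cdot\frac{\log(1/(\varepsilon p))}{\varepsilon^2p},$$ such that the maximum degree of $H$ is at most $C\,\frac{\log(1/(\varepsilon p))}{\varepsilon^2p}$ and $$\mathbb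 E[\mu(G_p)]\;\le\;\Bigl(\tfrac32+\varepsilon\Bigr)\,\mathbb E[\mu(H_p)].$$ Here the real parameters $\varepsilon,p$ are given to the algorithm as any positive rational numbers $\varepsilon_0,p_0$, written in binary, with $\varepsilon/2\le\varepsilon_0\le\varepsilon$ and $p/2\le p_0\le p$ (for instance $\varepsilon_0=\varepsilon$ and $p_0=p$ if these are rational), and the running time is polynomial in the bit length of the input $(G,\varepsilon_0,p_0)$. -/

import Mathlib

/-! ### Graphs: matching number, maximum degree, edge-degree constrained subgraphs -/

/-- The size of a maximum matching of `G`. -/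
noncomputable def matchingNumber {V : Type*} (G : SimpleGraph V) : ℕ :=
  sSup {k : ℕ | ∃ M : G.Subgraph, M.IsMatching ∧ M.edgeSet.ncard = k}

/-- The degree of `v` in `G` (no decidability of adjacency required). -/
noncomputable def vertexDegree {V : Type*} (G : SimpleGraph V) (v : V) : ℕ :=
  (G.neighborSet v).ncard

/-- `H` is an edge-degree constrained subgraph `EDCS(G, β, β')` of `G`. -/
structure IsEDCS {V : Type*} (G H : SimpleGraph V) (β β' : ℕ) : Prop where
  le : H ≤ G
  degree_add_le : ∀ u v, H.Adj u v → vertexDegree H u + vertexDegree H v ≤ β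
  le_degree_add : ∀ u v, G.Adj u v → ¬ H.Adj u v → β' ≤ vertexDegree H u + vertexDegree H v

/-! ### Random realizations -/

/-- The law of the realization `G_p`: every edge of `G` is kept independently with
probability `p`. -/
noncomputable def realizationLaw {V : Type*} (G : SimpleGraph V) (p : unitInterval) :
    MeasureTheory.Measure (SimpleGraph V) :=
  (ProbabilityTheory.setBernoulli G.edgeSet p).map SimpleGraph.fromEdgeSet

/-- For a subgraph `H` of `G`, the expectation of `μ(H_p)`, where `H_p = H ∩ G_p` and `G_p` is a
realization of `G`. For `H = G` this is the expectation of `μ(G_p)`. -/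
noncomputable def expectedMatching {V : Type*} (G H : SimpleGraph V) (p : unitInterval) : ℝ :=
  ∫ K, (matchingNumber (H ⊓ K) : ℝ) ∂(realizationLaw G p)

/-! ### Deterministic random access machines with unit cost

The only arithmetic operations are addition and truncated subtraction, so that the numbers in the
machine gain at most one bit per step and polynomial time has its usual meaning. -/

namespace RAM

/-- A memory: registers and arrays of natural numbers, each indexed by natural numbers
(every program names only finitely many registers and arrays). -/
structure Mem where
  reg : ℕ → ℕ
  arr : ℕ → ℕ → ℕ

/-- Write a register. -/
def Mem.setReg (σ : Mem) (r x : ℕ) : Mem :=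
  { σ with reg := Function.update σ.reg r x }

/-- Write a cell of an array. -/
def Mem.setArr (σ : Mem) (a i x : ℕ) : Mem :=
  { σ with arr := Function.update σ.arr a (Function.update (σ.arr a) i x) }

/-- Programs. -/
inductive Prog where
  /-- `r := k` -/
  | const (r k : ℕ)
  /-- `r := s + t` -/
  | add (r s t : ℕ)
  /-- `r := s - t`, or `0` if `s < t` -/
  | sub (r s t : ℕ)
  /-- `r := a[i]`, where `i` is a register -/
  | load (r a i : ℕ)
  /-- `a[i] := s`, where `i` and `s` are registers -/
  | store (a i s : ℕ)
  /-- first `P`, then `Q` -/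
  | seq (P Q : Prog)
  /-- if `r ≠ 0` then `P` else `Q` -/
  | ite (r : ℕ) (P Q : Prog)
  /-- while `r ≠ 0` do `P` -/
  | while (r : ℕ) (P : Prog)

/-- `Exec P σ t τ`: started in memory `σ`, the program `P` halts after exactly `t` steps in
memory `τ`. Every assignment and every test costs one step. -/
inductive Exec : Prog → Mem → ℕ → Mem → Prop where
  | const (r k : ℕ) (σ : Mem) : Exec (.const r k) σ 1 (σ.setReg r k)
  | add (r s t : ℕ) (σ : Mem) : Exec (.add r s t) σ 1 (σ.setReg r (σ.reg s + σ.reg t))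
  | sub (r s t : ℕ) (σ : Mem) : Exec (.sub r s t) σ 1 (σ.setReg r (σ.reg s - σ.reg t))
  | load (r a i : ℕ) (σ : Mem) : Exec (.load r a i) σ 1 (σ.setReg r (σ.arr a (σ.reg i)))
  | store (a i s : ℕ) (σ : Mem) : Exec (.store a i s) σ 1 (σ.setArr a (σ.reg i) (σ.reg s))
  | seq {P Q : Prog} {σ τ ρ : Mem} {t t' : ℕ} :
      Exec P σ t τ → Exec Q τ t' ρ → Exec (.seq P Q) σ (t + t') ρ
  | ite_true {r : ℕ} {P Q : Prog} {σ τ : Mem} {t : ℕ} :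
      σ.reg r ≠ 0 → Exec P σ t τ → Exec (.ite r P Q) σ (t + 1) τ
  | ite_false {r : ℕ} {P Q : Prog} {σ τ : Mem} {t : ℕ} :
      σ.reg r = 0 → Exec Q σ t τ → Exec (.ite r P Q) σ (t + 1) τ
  | while_true {r : ℕ} {P : Prog} {σ τ ρ : Mem} {t t' : ℕ} :
      σ.reg r ≠ 0 → Exec P σ t τ → Exec (.while r P) τ t' ρ →
        Exec (.while r P) σ (t + t' + 1) ρ
  | while_false {r : ℕ} {P : Prog} {σ : Mem} :
      σ.reg r = 0 → Exec (.while r P) σ 1 σ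

/-- Programs are deterministic: the final memory and the step count are unique. -/
theorem Exec.deterministic {P : Prog} {σ τ τ' : Mem} {t t' : ℕ}
    (h : Exec P σ t τ) (h' : Exec P σ t' τ') : t = t' ∧ τ = τ' := by
  induction h generalizing t' τ' with
  | const => cases h'; simp
  | add => cases h'; simp
  | sub => cases h'; simp
  | load => cases h'; simp
  | store => cases h'; simp
  | seq _ _ ih₁ ih₂ =>
    cases h' with
    | seq h₁ h₂ =>
      obtain ⟨rfl, rfl⟩ := ih₁ h₁
      obtain ⟨rfl, rfl⟩ := ih₂ h₂
      simp
  | ite_true hr _ ih =>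
    cases h' with
    | ite_true _ h₁ => obtain ⟨rfl, rfl⟩ := ih h₁; simp
    | ite_false hr' => exact absurd hr' hr
  | ite_false hr _ ih =>
    cases h' with
    | ite_true hr' => exact absurd hr hr'
    | ite_false _ h₁ => obtain ⟨rfl, rfl⟩ := ih h₁; simp
  | while_true hr _ _ ih₁ ih₂ =>
    cases h' with
    | while_true _ h₁ h₂ =>
      obtain ⟨rfl, rfl⟩ := ih₁ h₁
      obtain ⟨rfl, rfl⟩ := ih₂ h₂
      simp
    | while_false hr' => exact absurd hr' hr
  | while_false hr =>
    cases h' with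
    | while_true hr' => exact absurd hr hr'
    | while_false => simp

/-- Array number `a` of `σ` holds the adjacency matrix of `G`, row by row. -/
def Mem.HoldsGraph (σ : Mem) (a : ℕ) {n : ℕ} (G : SimpleGraph (Fin n)) : Prop :=
  ∀ u v : Fin n, (G.Adj u v → σ.arr a (u * n + v) = 1) ∧ (¬ G.Adj u v → σ.arr a (u * n + v) = 0)

open Classical in
/-- The initial memory on input a graph `G` on `n` vertices and positive rationals `ε`, `p`:
registers `0, …, 4` hold `n` and the numerators and denominators of `ε` and `p`, array `0` holds
the adjacency matrix of `G`, and everything else is zero. -/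
noncomputable def inputMem {n : ℕ} (G : SimpleGraph (Fin n)) (ε p : ℚ) : Mem where
  reg r := [n, ε.num.toNat, ε.den, p.num.toNat, p.den].getD r 0
  arr a i := if a = 0 ∧ ∃ u v : Fin n, G.Adj u v ∧ i = u * n + v then 1 else 0

/-- The bit length of the input. -/
def inputSize (n : ℕ) (ε p : ℚ) : ℕ :=
  n ^ 2 + n.size + ε.num.toNat.size + ε.den.size + p.num.toNat.size + p.den.size

/-- The map `A`, from graphs with two positive rational parameters to graphs on the same vertices,
is computed by a deterministic algorithm in time polynomial in the bit length of the input; the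
output is the adjacency matrix in array `1`. -/
def PolyTimeComputable
    (A : ∀ n : ℕ, SimpleGraph (Fin n) → ℚ → ℚ → SimpleGraph (Fin n)) : Prop :=
  ∃ (P : Prog) (q : Polynomial ℕ), ∀ (n : ℕ) (G : SimpleGraph (Fin n)) (ε p : ℚ),
    0 < ε → 0 < p → ∃ (t : ℕ) (τ : Mem),
      Exec P (inputMem G ε p) t τ ∧ t ≤ q.eval (inputSize n ε p) ∧ τ.HoldsGraph 1 (A n G ε p)

end RAM

open Finset

/-! ### Matchings as involutions -/

/-- A matching of `H`, encoded as the involution that exchanges the two ends of each of its edges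
and fixes every uncovered vertex. -/
structure IsMate {V : Type*} (H : SimpleGraph V) (f : V → V) : Prop where
  invol : ∀ v, f (f v) = v
  adj : ∀ v, f v ≠ v → H.Adj v (f v)

/-- The vertices covered by a matching. -/
def covered {V : Type*} [Fintype V] [DecidableEq V] (f : V → V) : Finset V :=
  univ.filter fun v => f v ≠ v

section Mate

variable {V : Type*} {H : SimpleGraph V} {f : V → V}

/-- Delete all edges that touch `U`. -/
def avoid (H : SimpleGraph V) (U : Finset V) : SimpleGraph V where
  Adj a b := H.Adj a b ∧ a ∉ U ∧ b ∉ U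
  symm := ⟨fun _ _ h => ⟨h.1.symm, h.2.2, h.2.1⟩⟩
  loopless := ⟨fun _ h => H.loopless.irrefl _ h.1⟩

theorem avoid_le (H : SimpleGraph V) (U : Finset V) : avoid H U ≤ H := fun _ _ h => h.1

theorem IsMate.mono {K : SimpleGraph V} (hf : IsMate H f) (h : H ≤ K) : IsMate K f :=
  ⟨hf.invol, fun v hv => h (hf.adj v hv)⟩

/-- Add the edge `xy` to a matching, deleting the edges that covered `x` or `y`. -/
def rematch [DecidableEq V] (g : V → V) (x y : V) : V → V := fun w =>
  if w = x then y else if w = y then x else if w = g x ∨ w = g y then w else g w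

theorem IsMate.rematch [DecidableEq V] {g : V → V} (hg : IsMate H g) {x y : V} (hxy : H.Adj x y) :
    IsMate H (rematch g x y) := by
  have hne := hxy.ne
  have hi := hg.invol
  refine ⟨fun v => ?_, fun v hv => ?_⟩
  · unfold _root_.rematch
    grind
  · unfold _root_.rematch at hv ⊢
    have := hg.adj v
    have := hxy.symm
    grind

variable [Fintype V]

theorem SimpleGraph.Subgraph.IsMatching.two_mul_ncard_edgeSet {M : H.Subgraph}
    (hM : M.IsMatching) : 2 * M.edgeSet.ncard = M.verts.ncard := by
  classical
  have h := M.spanningCoe.sum_degrees_eq_twice_card_edges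
  have hdeg : ∀ v, M.spanningCoe.degree v = if v ∈ M.verts then 1 else 0 := by
    intro v
    rw [← SimpleGraph.card_neighborFinset_eq_degree]
    split_ifs with hv
    · obtain ⟨w, hw, huniq⟩ := hM hv
      rw [Finset.card_eq_one]
      refine ⟨w, ?_⟩
      ext x
      simp only [SimpleGraph.mem_neighborFinset, SimpleGraph.Subgraph.spanningCoe_adj,
        Finset.mem_singleton]
      exact ⟨fun h => huniq x h, fun h => h ▸ hw⟩
    · rw [Finset.card_eq_zero, Finset.eq_empty_iff_forall_notMem]
      intro x hx
      simp only [SimpleGraph.mem_neighborFinset, SimpleGraph.Subgraph.spanningCoe_adj] at hx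
      exact hv (M.edge_vert hx)
  simp only [hdeg, Finset.sum_boole, Nat.cast_id] at h
  have h1 : M.edgeSet.ncard = #M.spanningCoe.edgeFinset := by
    rw [← Set.ncard_coe_finset, SimpleGraph.coe_edgeFinset,
      SimpleGraph.Subgraph.edgeSet_spanningCoe]
  have h2 : M.verts.ncard = #(univ.filter fun v => v ∈ M.verts) := by
    rw [← Set.ncard_coe_finset]; simp
  rw [h1, h2, h]

theorem bddAbove_matching_sizes (H : SimpleGraph V) :
    BddAbove {k : ℕ | ∃ M : H.Subgraph, M.IsMatching ∧ M.edgeSet.ncard = k} := by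
  refine ⟨Fintype.card V, ?_⟩
  rintro k ⟨M, hM, rfl⟩
  have h1 := hM.two_mul_ncard_edgeSet
  have h2 : M.verts.ncard ≤ Fintype.card V := by
    rw [← Nat.card_eq_fintype_card]; exact Set.ncard_le_card _
  omega

variable [DecidableEq V]

@[simp] theorem mem_covered {v : V} : v ∈ covered f ↔ f v ≠ v := by simp [covered]

theorem IsMate.exists_isMatching (hf : IsMate H f) :
    ∃ M : H.Subgraph, M.IsMatching ∧ 2 * M.edgeSet.ncard = #(covered f) := by
  let M : H.Subgraph :=
    { verts := {v | f v ≠ v}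
      Adj := fun u v => f u = v ∧ u ≠ v
      adj_sub := by
        rintro u v ⟨rfl, h⟩
        exact hf.adj u h.symm
      edge_vert := by
        rintro u v ⟨rfl, h⟩
        exact h.symm
      symm := ⟨by
        rintro u v ⟨rfl, h⟩
        exact ⟨hf.invol u, h.symm⟩⟩ }
  have hM : M.IsMatching := by
    intro v hv
    exact ⟨f v, ⟨rfl, fun h => hv h.symm⟩, fun y hy => hy.1.symm⟩
  refine ⟨M, hM, ?_⟩
  rw [hM.two_mul_ncard_edgeSet, ← Set.ncard_coe_finset]
  congr 1
  ext v
  simp [M]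

theorem SimpleGraph.Subgraph.IsMatching.exists_isMate {M : H.Subgraph} (hM : M.IsMatching) :
    ∃ f : V → V, IsMate H f ∧ #(covered f) = 2 * M.edgeSet.ncard ∧
      ∀ v, f v ≠ v → M.Adj v (f v) := by
  classical
  have hM' := @hM
  choose g hg hu using hM'
  let f : V → V := fun v => if h : v ∈ M.verts then g h else v
  have hadj : ∀ v, f v ≠ v → M.Adj v (f v) := by
    intro v hv
    by_cases h : v ∈ M.verts
    · simpa [f, h] using hg h
    · simp [f, h] at hv
  refine ⟨f, ⟨?_, fun v hv => (hadj v hv).adj_sub⟩, ?_, hadj⟩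
  · intro v
    by_cases h : f v = v
    · rw [h, h]
    · have h1 := hadj v h
      have h2 := M.edge_vert h1.symm
      have : f (f v) = g h2 := by simp only [f, dif_pos h2]
      rw [this]
      exact (hu h2 v h1.symm).symm
  · rw [hM.two_mul_ncard_edgeSet, ← Set.ncard_coe_finset]
    congr 1
    ext v
    simp only [coe_filter, covered, mem_univ, true_and, Set.mem_ofPred_eq]
    constructor
    · intro h
      exact M.edge_vert (hadj v h)
    · intro h
      simp only [f, dif_pos h]
      exact (hg h).adj_sub.ne'

theorem IsMate.card_covered_le (hf : IsMate H f) : #(covered f) ≤ 2 * matchingNumber H := by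
  obtain ⟨M, hM, h⟩ := hf.exists_isMatching
  rw [← h]
  exact Nat.mul_le_mul_left _ (le_csSup (bddAbove_matching_sizes H) ⟨M, hM, rfl⟩)

theorem exists_isMate_card_covered (H : SimpleGraph V) :
    ∃ f, IsMate H f ∧ #(covered f) = 2 * matchingNumber H := by
  obtain ⟨M, hM, h⟩ := Nat.sSup_mem
    (s := {k : ℕ | ∃ M : H.Subgraph, M.IsMatching ∧ M.edgeSet.ncard = k})
    ⟨0, ⊥, by intro v hv; simp at hv, by simp⟩ (bddAbove_matching_sizes H)
  obtain ⟨f, hf, hc, -⟩ := hM.exists_isMate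
  exact ⟨f, hf, by rw [hc, h]; rfl⟩

theorem IsMate.even_card_covered (hf : IsMate H f) : Even #(covered f) := by
  obtain ⟨M, -, h⟩ := hf.exists_isMatching
  exact ⟨_, by rw [← h, two_mul]⟩

theorem matchingNumber_mono {H K : SimpleGraph V} (h : H ≤ K) :
    matchingNumber H ≤ matchingNumber K := by
  obtain ⟨f, hf, hc⟩ := exists_isMate_card_covered H
  have := (hf.mono h).card_covered_le
  omega

/-- A maximum matching covers an end of each edge. -/
theorem IsMate.covers_of_max {g : V → V} (hg : IsMate H g)
    (hmax : #(covered g) = 2 * matchingNumber H) {x y : V} (hxy : H.Adj x y) (hx : g x = x) :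
    g y ≠ y := by
  intro hy
  have hne := hxy.ne
  have h1 := (hg.rematch hxy).card_covered_le
  have h2 : covered (_root_.rematch g x y) = insert x (insert y (covered g)) := by
    ext w
    simp only [mem_covered, Finset.mem_insert]
    unfold _root_.rematch
    grind
  rw [h2, card_insert_of_notMem (by simp [hne, hx]), card_insert_of_notMem (by simp [hy])] at h1
  omega

theorem card_covered_rematch {g : V → V} (hg : IsMate H g) {x y : V} (hxy : H.Adj x y)
    (hx : g x = x) (hy : g y ≠ y) : #(covered (rematch g x y)) = #(covered g) := by
  have hne := hxy.ne
  have hi := hg.invol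
  have h2 : covered (rematch g x y) = insert x ((covered g).erase (g y)) := by
    ext w
    simp only [mem_covered, Finset.mem_insert, Finset.mem_erase]
    unfold rematch
    grind
  have hmem : g y ∈ covered g := by simp only [mem_covered]; rw [hi]; exact hy.symm
  have := Finset.card_pos.2 ⟨_, hmem⟩
  rw [h2, card_insert_of_notMem (by simp [hx]), card_erase_of_mem hmem]
  omega

/-- Gallai's lemma: if every vertex is missed by some maximum matching, then no maximum matching
misses two vertices of the same connected component. -/
theorem gallai_lemma
    (hmiss : ∀ v, ∃ g, IsMate H g ∧ #(covered g) = 2 * matchingNumber H ∧ g v = v)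
    (d : ℕ) : ∀ (u v : V) (f : V → V), H.Reachable u v → H.dist u v = d → u ≠ v →
      IsMate H f → #(covered f) = 2 * matchingNumber H → f u = u → f v = v → False := by
  induction d using Nat.strong_induction_on with
  | _ d ih =>
  intro u v f hr hd huv hf hfmax hfu hfv
  by_cases hadj : H.Adj u v
  · exact hf.covers_of_max hfmax hadj hfu hfv
  obtain ⟨t, hut, htv, hdt⟩ : ∃ t, H.Adj u t ∧ H.Reachable t v ∧ H.dist t v < d := by
    obtain ⟨w, hw⟩ := hr.exists_walk_length_eq_dist
    cases w with
    | nil => exact absurd rfl huv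
    | cons h q =>
      refine ⟨_, h, q.reachable, ?_⟩
      rw [SimpleGraph.Walk.length_cons] at hw
      have := SimpleGraph.dist_le q
      omega
  have htv' : t ≠ v := fun h => hadj (h ▸ hut)
  have hft : f t ≠ t := hf.covers_of_max hfmax hut hfu
  classical
  obtain ⟨g, hgmem, hgmax⟩ := Finset.exists_max_image
    (univ.filter fun g : V → V => IsMate H g ∧ #(covered g) = 2 * matchingNumber H ∧ g t = t)
    (fun g => #(univ.filter fun w => f w ≠ w ∧ g w = f w))
    (by obtain ⟨g, hg⟩ := hmiss t; exact ⟨g, by simpa using hg⟩)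
  simp only [mem_filter, mem_univ, true_and] at hgmem hgmax
  obtain ⟨hg, hgc, hgt⟩ := hgmem
  have hgu : g u ≠ u := hg.covers_of_max hgc hut.symm hgt
  have hgv : g v ≠ v := fun h => ih _ hdt t v g htv rfl htv' hg hgc hgt h
  obtain ⟨x, hx, hxt⟩ : ∃ x ∈ covered f \ covered g, x ≠ t := by
    apply Finset.exists_mem_ne
    have h1 : #(covered f \ covered g) = #(covered g \ covered f) :=
      Finset.card_sdiff_comm (by rw [hfmax, hgc])
    rw [h1]
    exact Finset.one_lt_card.2 ⟨u, by simp [hgu, hfu], v, by simp [hgv, hfv], huv⟩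
  simp only [mem_sdiff, mem_covered, not_not] at hx
  obtain ⟨hfx, hgx⟩ := hx
  have hxy := hf.adj x hfx
  have hgy : g (f x) ≠ f x := hg.covers_of_max hgc hxy hgx
  have hi := hg.invol
  have hfi := hf.invol
  have hbetter := hgmax (rematch g x (f x)) ⟨hg.rematch hxy,
    by rw [card_covered_rematch hg hxy hgx hgy, hgc], by unfold rematch; grind⟩
  refine absurd hbetter (not_le.2 (Finset.card_lt_card ?_))
  rw [Finset.ssubset_iff_of_subset]
  · refine ⟨x, ?_, ?_⟩
    · simp only [mem_filter, mem_univ, true_and]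
      exact ⟨hfx, by simp [rematch]⟩
    · simp only [mem_filter, mem_univ, true_and, not_and]
      intro _ h
      exact hfx (h ▸ hgx)
  · intro w
    simp only [mem_filter, mem_univ, true_and]
    unfold rematch
    grind

/-- The nontrivial half of the Tutte–Berge formula. The vertices outside `U` are grouped by a
labelling that is constant on the connected components of `H - U`. -/
theorem exists_tutte_berge (H : SimpleGraph V) :
    ∃ (U : Finset V) (c : V → V), (∀ u v, u ∉ U → v ∉ U → H.Adj u v → c u = c v) ∧
      #U + ∑ i, #(univ.filter fun v => v ∉ U ∧ c v = i) / 2 ≤ matchingNumber H := by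
  classical
  obtain ⟨U, hU, hUmax⟩ := Finset.exists_max_image
    (univ.filter fun U : Finset V => matchingNumber (avoid H U) + #U ≤ matchingNumber H)
    (fun U => #U)
    ⟨∅, by simpa using matchingNumber_mono (avoid_le H ∅)⟩
  simp only [mem_filter, mem_univ, true_and] at hU hUmax
  set K := avoid H U with hK
  have hmiss : ∀ v, ∃ g, IsMate K g ∧ #(covered g) = 2 * matchingNumber K ∧ g v = v := by
    intro v
    by_contra hcon
    push Not at hcon
    have hvU : v ∉ U := by
      intro hv
      obtain ⟨g, hg, hgc⟩ := exists_isMate_card_covered K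
      exact (hg.adj v (hcon g hg hgc)).2.1 hv
    have hle : avoid H (insert v U) ≤ K := fun a b h =>
      ⟨h.1, fun ha => h.2.1 (mem_insert_of_mem ha), fun hb => h.2.2 (mem_insert_of_mem hb)⟩
    obtain ⟨g, hg, hgc⟩ := exists_isMate_card_covered (avoid H (insert v U))
    have hgv : g v = v := by
      by_contra h
      exact (hg.adj v h).2.1 (mem_insert_self _ _)
    have h1 := matchingNumber_mono hle
    have h2 : #(covered g) ≠ 2 * matchingNumber K := fun h => hcon g (hg.mono hle) h hgv
    have h3 := hUmax (insert v U) (by rw [card_insert_of_notMem hvU]; omega)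
    rw [card_insert_of_notMem hvU] at h3
    omega
  let c : V → V := fun v => (K.connectedComponentMk v).out
  have hc : ∀ u v, c u = c v → K.Reachable u v := by
    intro u v h
    have : K.connectedComponentMk u = K.connectedComponentMk v := 
      (Quot.out_eq _).symm.trans ((congrArg (Quot.mk K.Reachable) h).trans (Quot.out_eq _))
    exact SimpleGraph.ConnectedComponent.exact this
  have hc' : ∀ u v, K.Adj u v → c u = c v := by
    intro u v h
    simp only [c]
    rw [SimpleGraph.ConnectedComponent.sound h.reachable]
  refine ⟨U, c, fun u v hu hv h => hc' u v ⟨h, hu, hv⟩, ?_⟩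
  obtain ⟨f, hf, hfc⟩ := exists_isMate_card_covered K
  have hsum : #(covered f) = ∑ i, #((covered f).filter fun v => c v = i) :=
    Finset.card_eq_sum_card_fiberwise (fun _ _ => by simp)
  have hcomp : ∀ i, 2 * (#(univ.filter fun v => v ∉ U ∧ c v = i) / 2) ≤
      #((covered f).filter fun v => c v = i) := by
    intro i
    have heven : Even #((covered f).filter fun v => c v = i) := by
      have hm : IsMate K fun v => if c v = i then f v else v := by
        constructor
        · intro v
          by_cases h : c v = i
          · by_cases h' : f v = v
            · simp [h, h']
            · have : c (f v) = i := by rw [← hc' _ _ (hf.adj v h'), h]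
              simp [h, this, hf.invol]
          · simp [h]
        · intro v hv
          by_cases h : c v = i
          · simp only [h, if_true] at hv ⊢
            exact hf.adj v hv
          · simp [h] at hv
      convert hm.even_card_covered using 2
      ext v
      simp only [mem_filter, mem_covered]
      split_ifs with h <;> simp [h]
    have hmis : #((univ.filter fun v => v ∉ U ∧ c v = i) \
        ((covered f).filter fun v => c v = i)) ≤ 1 := by
      rw [Finset.card_le_one]
      intro a ha b hb
      simp only [mem_sdiff, mem_filter, mem_univ, true_and, mem_covered] at ha hb
      by_contra hab
      exact gallai_lemma hmiss _ a b f (hc a b (by rw [ha.1.2, hb.1.2])) rfl hab hf hfc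
        (by grind) (by grind)
    have h3 := Finset.le_card_sdiff ((covered f).filter fun v => c v = i)
      (univ.filter fun v => v ∉ U ∧ c v = i)
    obtain ⟨k, hk⟩ := heven
    omega
  have := Finset.sum_le_sum fun i (_ : i ∈ univ) => hcomp i
  rw [← Finset.mul_sum, ← hsum, hfc] at this
  omega

end Mate

/-! ### Matchings in graphs with edge-degree constraints -/

/-- In a bipartite graph in which the degrees of the ends of each edge sum to at most `b`, the
number of edges is at most `b / 4` times the number of vertices. -/
theorem sum_card_filter_le {α γ : Type*} (S : Finset α) (T : Finset γ) (r : α → γ → Prop)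
    [∀ s t, Decidable (r s t)] {b : ℝ} (hb : 0 < b)
    (h : ∀ s ∈ S, ∀ t ∈ T, r s t →
      (#(T.filter (r s)) : ℝ) + #(S.filter fun s => r s t) ≤ b) :
    ∑ s ∈ S, (#(T.filter (r s)) : ℝ) ≤ (#S + #T) * b / 4 := by
  set a : α → ℝ := fun s => #(T.filter (r s)) with ha
  set d : γ → ℝ := fun t => #(S.filter fun s => r s t) with hd
  have hab : ∑ s ∈ S, a s = ∑ t ∈ T, d t := by
    simp only [ha, hd]
    exact_mod_cast Finset.sum_card_bipartiteAbove_eq_sum_card_bipartiteBelow r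
  have hone : ∀ s, ∑ t ∈ T, (if r s t then (1 : ℝ) else 0) = a s := fun s => by simp [ha]
  have htwo : ∀ t, ∑ s ∈ S, (if r s t then (1 : ℝ) else 0) = d t := fun t => by simp [hd]
  have key : ∑ s ∈ S, ∑ t ∈ T, (if r s t then (1 : ℝ) else 0) * (a s + d t) ≤
      ∑ s ∈ S, ∑ t ∈ T, (if r s t then (1 : ℝ) else 0) * b := by
    refine sum_le_sum fun s hs => sum_le_sum fun t ht => ?_
    split_ifs with hr
    · simpa using h s hs t ht hr
    · simp
  have hl : ∑ s ∈ S, ∑ t ∈ T, (if r s t then (1 : ℝ) else 0) * (a s + d t) =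
      ∑ s ∈ S, a s ^ 2 + ∑ t ∈ T, d t ^ 2 := by
    simp only [mul_add, sum_add_distrib]
    congr 1
    · refine sum_congr rfl fun s _ => ?_
      rw [← sum_mul, hone, sq]
    · rw [sum_comm]
      refine sum_congr rfl fun t _ => ?_
      rw [← sum_mul, htwo, sq]
  have hr : ∑ s ∈ S, ∑ t ∈ T, (if r s t then (1 : ℝ) else 0) * b = (∑ s ∈ S, a s) * b := by
    rw [sum_mul]
    refine sum_congr rfl fun s _ => ?_
    rw [← sum_mul, hone]
  rw [hl, hr] at key
  have hsq : 0 ≤ ∑ s ∈ S, (a s - b / 2) ^ 2 + ∑ t ∈ T, (d t - b / 2) ^ 2 := by positivity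
  have e1 : ∑ s ∈ S, (a s - b / 2) ^ 2 =
      ∑ s ∈ S, a s ^ 2 - b * ∑ s ∈ S, a s + #S * (b ^ 2 / 4) := by
    rw [mul_sum, ← sum_sub_distrib, ← nsmul_eq_mul, ← sum_const, ← sum_add_distrib]
    exact sum_congr rfl fun s _ => by ring
  have e2 : ∑ t ∈ T, (d t - b / 2) ^ 2 =
      ∑ t ∈ T, d t ^ 2 - b * ∑ t ∈ T, d t + #T * (b ^ 2 / 4) := by
    rw [mul_sum, ← sum_sub_distrib, ← nsmul_eq_mul, ← sum_const, ← sum_add_distrib]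
    exact sum_congr rfl fun s _ => by ring
  rw [e1, e2, ← hab] at hsq
  have : b * ∑ s ∈ S, a s ≤ b * ((#S + #T) * b / 4) := by nlinarith
  exact le_of_mul_le_mul_left this hb

theorem vertexDegree_eq_card {V : Type*} [Fintype V] (H : SimpleGraph V) [DecidableRel H.Adj] (v : V) :
    vertexDegree H v = #(univ.filter fun w => H.Adj v w) := by
  rw [vertexDegree, ← Set.ncard_coe_finset]
  congr 1
  ext w
  simp

section

variable {V : Type*} [Fintype V] [DecidableEq V]

theorem even_card_of_involution {f : V → V} {s : Finset V}
    (h : ∀ v ∈ s, f v ∈ s ∧ f v ≠ v ∧ f (f v) = v) : Even #s := by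
  have hm : IsMate (⊤ : SimpleGraph V) fun v => if v ∈ s then f v else v := by
    constructor
    · intro v
      by_cases hv : v ∈ s
      · simp [hv, h v hv]
      · simp [hv]
    · intro v hv
      exact hv.symm
  convert hm.even_card_covered using 2
  ext v
  simp only [mem_covered]
  by_cases hv : v ∈ s
  · simp [hv, (h v hv).2.1]
  · simp [hv]

theorem tutte_berge_arith {lam b U L F k l m : ℝ} (hlam : 0 < lam) (hlam' : lam ≤ 1 / 100)
    (hb : 1 ≤ lam ^ 2 * b) (hU : 0 ≤ U) (hF : 0 ≤ F) (hl : 0 ≤ l)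
    (hk : k * ((1 - 3 * lam) * b) ≤ (2 * k + (2 * U + L)) * b / 4)
    (hlL : l * (lam * b) ≤ L) (hLF : L ≤ 2 * F + l) (hm : U + F ≤ m) :
    k + l ≤ (1 + 16 * lam) * m := by
  have hb0 : 0 < b := by
    by_contra h
    nlinarith [sq_nonneg lam]
  have h1 : k * (2 - 12 * lam) ≤ 2 * U + L := by
    have : k * (2 - 12 * lam) * b ≤ (2 * U + L) * b := by nlinarith
    exact le_of_mul_le_mul_right this hb0
  have h2 : l ≤ lam * L := by
    have : l ≤ l * (lam ^ 2 * b) := le_mul_of_one_le_right hl hb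
    nlinarith
  have h3 : L * (1 - lam) ≤ 2 * F := by linarith
  have hL : L ≤ 2 * F * (1 + 2 * lam) := by
    have : L * (1 - lam) ≤ 2 * F * (1 + 2 * lam) * (1 - lam) := by
      nlinarith [mul_nonneg hF hlam.le, mul_nonneg (mul_nonneg hF hlam.le) hlam.le]
    exact le_of_mul_le_mul_right this (by linarith)
  have hl' : l ≤ 3 * lam * F := by nlinarith [mul_nonneg hF hlam.le]
  have hk' : k ≤ (U + F * (1 + 2 * lam)) * (1 + 7 * lam) := by
    have : k * (2 - 12 * lam) ≤ (U + F * (1 + 2 * lam)) * (1 + 7 * lam) * (2 - 12 * lam) := by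
      have h5 : 0 ≤ U + F * (1 + 2 * lam) := by positivity
      have h6 : 2 ≤ (1 + 7 * lam) * (2 - 12 * lam) := by nlinarith
      nlinarith
    exact le_of_mul_le_mul_right this (by linarith)
  have : U * (7 * lam) + F * (9 * lam + 14 * lam ^ 2) + 3 * lam * F ≤ 16 * lam * (U + F) := by
    nlinarith [mul_nonneg hF hlam.le, mul_nonneg hU hlam.le]
  nlinarith

/-- If the degrees of the ends of each edge of `H` sum to at most `b`, and each edge of a matching
either belongs to `H` or has degree sum at least `(1 - λ) b`, then the matching is at most
`3/2 + O(λ)` times as large as a maximum matching of `H`. -/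
theorem card_covered_le_of_degree_constraints (H : SimpleGraph V) {f : V → V}
    (hfi : ∀ v, f (f v) = v) {b lam : ℝ} (hlam : 0 < lam) (hlam' : lam ≤ 1 / 100)
    (hb : 1 ≤ lam ^ 2 * b)
    (hH : ∀ u v, H.Adj u v → (vertexDegree H u + vertexDegree H v : ℝ) ≤ b)
    (hf : ∀ v, f v ≠ v → H.Adj v (f v) ∨
      (1 - lam) * b ≤ vertexDegree H v + vertexDegree H (f v)) :
    (#(covered f) : ℝ) ≤ (3 + 16 * lam) * matchingNumber H := by
  classical
  have hb0 : 0 < b := by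
    by_contra h
    nlinarith [sq_nonneg lam]
  obtain ⟨U, c, hc, hTB⟩ := exists_tutte_berge H
  set N : V → Finset V := fun i => univ.filter fun v => v ∉ U ∧ c v = i with hN
  change #U + ∑ i, #(N i) / 2 ≤ _ at hTB
  let large : V → Prop := fun i => lam * b < #(N i)
  let L : Finset V := univ.filter fun v => v ∉ U ∧ large (c v)
  let lg : Finset V := univ.filter large
  let CQ : Finset V := univ.filter fun v =>
    v ∉ U ∧ f v ∉ U ∧ f v ≠ v ∧ c (f v) ≠ c v ∧ ¬ large (c v)
  let T : Finset (V × Bool) := univ.filter fun x => x.1 ∈ U ∨ (x.1 ∈ L ∧ x.2 = false)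
  let g : V × Bool → V := fun x => if x.2 then f x.1 else x.1
  let r : V × Bool → V × Bool → Prop := fun x y => H.Adj (g x) y.1 ∧ x.2 ≠ y.2
  have hfinj : Function.Injective f := fun a b h => by rw [← hfi a, h, hfi]
  have hdegS : ∀ x, (#(T.filter (r x)) : ℝ) ≤ vertexDegree H (g x) := by
    intro x
    rw [vertexDegree_eq_card]
    norm_cast
    refine Finset.card_le_card_of_injOn Prod.fst ?_ ?_
    · intro y hy
      simp only [coe_filter, Set.mem_ofPred_eq, mem_univ, true_and] at hy ⊢
      exact hy.2.1
    · rintro ⟨y, i⟩ hy ⟨z, j⟩ hz hyz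
      simp only [coe_filter, Set.mem_ofPred_eq, r] at hy hz
      have hi := hy.2.2
      have hj := hz.2.2
      have : i = j := by cases i <;> cases j <;> simp_all
      exact Prod.ext hyz this
  have hdegT : ∀ y, (#((CQ ×ˢ (univ : Finset Bool)).filter fun x => r x y) : ℝ) ≤
      vertexDegree H y.1 := by
    intro y
    rw [vertexDegree_eq_card]
    norm_cast
    refine Finset.card_le_card_of_injOn g ?_ ?_
    · intro x hx
      simp only [coe_filter, Set.mem_ofPred_eq, mem_univ, true_and] at hx ⊢
      exact hx.2.1.symm
    · rintro ⟨x, i⟩ hx ⟨z, j⟩ hz hxz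
      simp only [coe_filter, Set.mem_ofPred_eq, r] at hx hz
      have hi := hx.2.2
      have hj := hz.2.2
      have hij : i = j := by
        revert hi hj; cases i <;> cases j <;> simp
      subst hij
      refine Prod.ext ?_ rfl
      cases i
      · simpa [g] using hxz
      · exact hfinj (by simpa [g] using hxz)
  have hcount := sum_card_filter_le (CQ ×ˢ (univ : Finset Bool)) T r hb0
    (fun x _ y _ hxy => (add_le_add (hdegS x) (hdegT y)).trans (hH _ _ hxy.1))
  have hlow : ∀ w i, w ∉ U → (i = true ∨ ¬ large (c w)) → ∀ x : V × Bool, g x = w → x.2 = i →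
      (vertexDegree H w : ℝ) - lam * b ≤ #(T.filter (r x)) := by
    intro w i hw hi x hx hxi
    rw [vertexDegree_eq_card]
    by_cases hl : large (c w)
    · have hit : i = true := by tauto
      have : #(univ.filter fun z => H.Adj w z) ≤ #(T.filter (r x)) := by
        refine Finset.card_le_card_of_injOn (fun z => (z, false)) ?_ ?_
        · intro z hz
          simp only [coe_filter, Set.mem_ofPred_eq, mem_univ, true_and, T, r, L] at hz ⊢
          refine ⟨?_, hx ▸ hz, by simp [hxi, hit]⟩
          by_cases hzU : z ∈ U
          · simp [hzU]
          · exact mem_filter.2 ⟨mem_univ _, Or.inr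
              ⟨mem_filter.2 ⟨mem_univ _, hzU, hc w z hw hzU hz ▸ hl⟩, rfl⟩⟩
        · intro a _ b _ h
          exact (Prod.ext_iff.1 h).1
      have h' : (#(univ.filter fun z => H.Adj w z) : ℝ) ≤ #(T.filter (r x)) := by
        exact_mod_cast this
      nlinarith
    · have h1 : #((univ.filter fun z => H.Adj w z) \ N (c w)) ≤ #(T.filter (r x)) := by
        refine Finset.card_le_card_of_injOn (fun z => (z, !i)) ?_ ?_
        · intro z hz
          simp only [coe_filter, Set.mem_ofPred_eq, mem_univ, true_and, T, r, L, coe_sdiff,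
            Set.mem_sdiff, N] at hz ⊢
          refine ⟨?_, hx ▸ hz.1, by simp [hxi]⟩
          by_cases hzU : z ∈ U
          · simp [hzU]
          · exact absurd ⟨hzU, (hc w z hw hzU hz.1).symm⟩ hz.2
        · intro a _ b _ h
          exact (Prod.ext_iff.1 h).1
      have h2 := Finset.le_card_sdiff (N (c w)) (univ.filter fun z => H.Adj w z)
      have h3 : #(univ.filter fun z => H.Adj w z) ≤ #(T.filter (r x)) + #(N (c w)) := by omega
      have h4 : (#(univ.filter fun z => H.Adj w z) : ℝ) ≤ #(T.filter (r x)) + #(N (c w)) := by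
        exact_mod_cast h3
      have h5 : (#(N (c w)) : ℝ) ≤ lam * b := not_lt.1 hl
      linarith
  have hS : (#CQ : ℝ) * ((1 - 3 * lam) * b) ≤
      ∑ x ∈ CQ ×ˢ (univ : Finset Bool), (#(T.filter (r x)) : ℝ) := by
    rw [Finset.sum_product, ← nsmul_eq_mul, ← sum_const]
    refine sum_le_sum fun v hv => ?_
    simp only [CQ, mem_filter, mem_univ, true_and] at hv
    obtain ⟨hvU, hfvU, hne, hcross, hsm⟩ := hv
    rw [Fintype.sum_bool]
    have h1 := hlow v false hvU (Or.inr hsm) (v, false) (by simp [g]) rfl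
    have h2 := hlow (f v) true hfvU (Or.inl rfl) (v, true) (by simp [g]) rfl
    have h3 := (hf v hne).resolve_left fun h => hcross (hc v (f v) hvU hfvU h).symm
    linarith
  have hTcard : #T ≤ 2 * #U + #L := by
    have : T ⊆ (U ×ˢ (univ : Finset Bool)) ∪ (L ×ˢ {false}) := by
      intro x hx
      simp only [T, mem_filter, mem_univ, true_and] at hx
      simp only [mem_union, mem_product, mem_univ, and_true, mem_singleton]
      exact hx
    refine (card_le_card this).trans ((card_union_le _ _).trans ?_)
    simp [card_product]
    omega
  have hLsum : #L = ∑ i ∈ lg, #(N i) := by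
    rw [Finset.card_eq_sum_card_fiberwise (f := c) (t := lg)]
    · refine sum_congr rfl fun i hi => ?_
      congr 1
      ext v
      simp only [lg, L, N, mem_filter, mem_univ, true_and] at hi ⊢
      constructor
      · rintro ⟨⟨h1, -⟩, h2⟩; exact ⟨h1, h2⟩
      · rintro ⟨h1, rfl⟩; exact ⟨⟨h1, hi⟩, rfl⟩
    · intro v hv
      simp only [lg, L, coe_filter, mem_univ, true_and, Set.mem_ofPred_eq] at hv ⊢
      exact hv.2
  have hlgL : (#lg : ℝ) * (lam * b) ≤ #L := by
    rw [hLsum, ← nsmul_eq_mul, ← sum_const]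
    push_cast
    refine sum_le_sum fun i hi => ?_
    simp only [lg, mem_filter, mem_univ, true_and] at hi
    exact hi.le
  have hLF : #L ≤ 2 * ∑ i ∈ lg, #(N i) / 2 + #lg := by
    rw [hLsum, mul_sum, card_eq_sum_ones, ← sum_add_distrib]
    exact sum_le_sum fun i _ => by omega
  have hFle : ∑ i ∈ lg, #(N i) / 2 ≤ ∑ i, #(N i) / 2 :=
    sum_le_sum_of_subset (subset_univ _)
  let W : Finset V := univ.filter fun v => v ∉ U ∧ f v ∉ U ∧ f v ≠ v
  have hW : #W ≤ ∑ i, (2 * (#(N i) / 2)) + #lg + #CQ := by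
    have e1 : #W = ∑ i, #(W.filter fun v => c v = i) :=
      Finset.card_eq_sum_card_fiberwise (fun _ _ => by simp)
    have e2 : #CQ = ∑ i, #(CQ.filter fun v => c v = i) :=
      Finset.card_eq_sum_card_fiberwise (fun _ _ => by simp)
    have e3 : #lg = ∑ i, if large i then 1 else 0 := by simp [lg]
    rw [e1, e2, e3, ← sum_add_distrib, ← sum_add_distrib]
    refine sum_le_sum fun i _ => ?_
    have hle : #(W.filter fun v => c v = i) ≤ #(N i) := by
      refine card_le_card fun v hv => ?_
      simp only [W, N, mem_filter, mem_univ, true_and] at hv ⊢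
      exact ⟨hv.1.1, hv.2⟩
    by_cases hl : large i
    · simp only [hl, if_true]
      omega
    · by_cases hq : #(CQ.filter fun v => c v = i) = 0
      · have hev : Even #(W.filter fun v => c v = i) := by
          refine even_card_of_involution (f := f) fun v hv => ?_
          rw [card_eq_zero, filter_eq_empty_iff] at hq
          simp only [W, CQ, mem_filter, mem_univ, true_and] at hv hq ⊢
          obtain ⟨⟨h1, h2, h3⟩, h4⟩ := hv
          have h5 : c (f v) = c v := by
            by_contra h
            exact hq ⟨h1, h2, h3, h, h4 ▸ hl⟩ h4
          rw [hfi]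
          exact ⟨⟨⟨h2, h1, h3.symm⟩, by rw [h5, h4]⟩, h3, rfl⟩
        obtain ⟨k, hk⟩ := hev
        omega
      · omega
  have hcov : #(covered f) ≤ 2 * #U + #W := by
    have hsub : covered f ⊆ (U ∪ U.image f) ∪ W := by
      intro v hv
      simp only [mem_covered] at hv
      simp only [mem_union, mem_image, W, mem_filter, mem_univ, true_and]
      by_cases h1 : v ∈ U
      · exact Or.inl (Or.inl h1)
      · by_cases h2 : f v ∈ U
        · exact Or.inl (Or.inr ⟨f v, h2, hfi v⟩)
        · exact Or.inr ⟨h1, h2, hv⟩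
    have h1 := card_le_card hsub
    have h2 := card_union_le (U ∪ U.image f) W
    have h3 := card_union_le U (U.image f)
    have h4 := card_image_le (s := U) (f := f)
    omega
  rw [← mul_sum] at hW
  have hfin := tutte_berge_arith (U := #U) (L := #L) (F := (∑ i ∈ lg, #(N i) / 2 : ℕ))
    (k := #CQ) (l := #lg) (m := matchingNumber H) hlam hlam' hb (by positivity) (by positivity)
    (by positivity)
    (by
      refine hS.trans (hcount.trans ?_)
      have : (#T : ℝ) ≤ 2 * #U + #L := by exact_mod_cast hTcard
      rw [card_product]
      simp only [card_univ, Fintype.card_bool, Nat.cast_mul, Nat.cast_ofNat]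
      nlinarith)
    hlgL (by exact_mod_cast hLF) (by
      have : #U + ∑ i ∈ lg, #(N i) / 2 ≤ matchingNumber H := by omega
      exact_mod_cast this)
  have h6 : #(covered f) ≤ 2 * matchingNumber H + (#CQ + #lg) := by omega
  have h7 : (#(covered f) : ℝ) ≤ 2 * matchingNumber H + (#CQ + #lg) := by exact_mod_cast h6
  linarith

end

/-! ### Random subsets of a finite set -/

/-- The expectation of `φ F`, where the random set `F` contains each element of `E` independently
with probability `p`. -/
def bernoulliMean {ι : Type*} [DecidableEq ι] (E : Finset ι) (p : ℝ) (φ : Finset ι → ℝ) : ℝ :=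
  ∑ F ∈ E.powerset, p ^ #F * (1 - p) ^ #(E \ F) * φ F

section Bernoulli

variable {ι : Type*} [DecidableEq ι] {E : Finset ι} {p : ℝ}

theorem bernoulliMean_mono (hp : 0 ≤ p) (hp' : p ≤ 1) {φ ψ : Finset ι → ℝ}
    (h : ∀ F ⊆ E, φ F ≤ ψ F) : bernoulliMean E p φ ≤ bernoulliMean E p ψ := by
  refine sum_le_sum fun F hF => ?_
  have : 0 ≤ 1 - p := by linarith
  exact mul_le_mul_of_nonneg_left (h F (mem_powerset.1 hF)) (by positivity)

theorem bernoulliMean_add (φ ψ : Finset ι → ℝ) :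
    bernoulliMean E p (fun F => φ F + ψ F) = bernoulliMean E p φ + bernoulliMean E p ψ := by
  simp [bernoulliMean, mul_add, sum_add_distrib]

theorem bernoulliMean_const_mul (a : ℝ) (φ : Finset ι → ℝ) :
    bernoulliMean E p (fun F => a * φ F) = a * bernoulliMean E p φ := by
  simp only [bernoulliMean, mul_sum]
  exact sum_congr rfl fun F _ => by ring

theorem bernoulliMean_sum {κ : Type*} (s : Finset κ) (φ : κ → Finset ι → ℝ) :
    bernoulliMean E p (fun F => ∑ i ∈ s, φ i F) = ∑ i ∈ s, bernoulliMean E p (φ i) := by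
  simp only [bernoulliMean, mul_sum]
  rw [sum_comm]

theorem bernoulliMean_pow_card {D : Finset ι} (hD : D ⊆ E) (a : ℝ) :
    bernoulliMean E p (fun F => a ^ #(D ∩ F)) = (1 - p + p * a) ^ #D := by
  have h := prod_add (fun e => p * if e ∈ D then a else 1) (fun _ => 1 - p) E
  have h1 : ∏ e ∈ E, ((p * if e ∈ D then a else 1) + (1 - p)) = (1 - p + p * a) ^ #D := by
    rw [← prod_subset hD (by intro x _ hx; simp [hx])]
    rw [← prod_const]
    exact prod_congr rfl fun e he => by simp [he]; ring
  rw [← h1, h, bernoulliMean]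
  refine sum_congr rfl fun F _ => ?_
  rw [prod_mul_distrib, prod_const, prod_const, prod_ite, prod_const, prod_const_one, mul_one,
    inter_comm D F, filter_mem_eq_inter]
  ring

theorem bernoulliMean_one : bernoulliMean E p (fun _ => 1) = 1 := by
  simpa using bernoulliMean_pow_card (p := p) (empty_subset E) 1

theorem bernoulliMean_mem {e : ι} (he : e ∈ E) :
    bernoulliMean E p (fun F => if e ∈ F then 1 else 0) = p := by
  have h := bernoulliMean_pow_card (p := p) (singleton_subset_iff.2 he) 2
  have h2 : (fun F : Finset ι => (2 : ℝ) ^ #({e} ∩ F)) =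
      fun F => 1 + if e ∈ F then 1 else 0 := by
    funext F
    by_cases hF : e ∈ F
    · simp [hF, singleton_inter_of_mem]; norm_num
    · simp [hF, singleton_inter_of_notMem]
  rw [h2, bernoulliMean_add, bernoulliMean_one] at h
  simp only [card_singleton, pow_one] at h
  linarith

theorem bernoulliMean_exp_le (hp : 0 ≤ p) (hp' : p ≤ 1) {D : Finset ι} (hD : D ⊆ E) {t : ℝ}
    (ht : |t| ≤ 1) :
    bernoulliMean E p (fun F => Real.exp (t * (#(D ∩ F) - p * #D))) ≤
      Real.exp (#D * p * t ^ 2) := by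
  have h1 : (fun F : Finset ι => Real.exp (t * (#(D ∩ F) - p * #D))) =
      fun F => Real.exp (-(t * p * #D)) * Real.exp t ^ #(D ∩ F) := by
    funext F
    rw [← Real.exp_nat_mul, ← Real.exp_add]
    congr 1
    ring
  rw [h1, bernoulliMean_const_mul, bernoulliMean_pow_card hD]
  have h2 : 1 - p + p * Real.exp t ≤ Real.exp (p * (Real.exp t - 1)) := by
    have := Real.add_one_le_exp (p * (Real.exp t - 1))
    linarith
  have h0 : 0 ≤ 1 - p + p * Real.exp t := by
    have := Real.exp_pos t
    have : 0 ≤ 1 - p := by linarith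
    positivity
  have h3 : (1 - p + p * Real.exp t) ^ #D ≤ Real.exp (#D * (p * (Real.exp t - 1))) := by
    rw [Real.exp_nat_mul]
    exact pow_le_pow_left₀ h0 h2 _
  refine (mul_le_mul_of_nonneg_left h3 (Real.exp_pos _).le).trans ?_
  rw [← Real.exp_add]
  apply Real.exp_le_exp.2
  have h4 := (abs_le.1 (Real.abs_exp_sub_one_sub_id_le ht)).2
  have h5 : (#D * p) * (Real.exp t - 1 - t) ≤ (#D * p) * t ^ 2 :=
    mul_le_mul_of_nonneg_left h4 (by positivity)
  linarith

/-- A Chernoff bound. -/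
theorem bernoulliMean_deviation_le (hp : 0 ≤ p) (hp' : p ≤ 1) {D : Finset ι} (hD : D ⊆ E)
    {b lam : ℝ} (hDb : #D ≤ b) (hlam : 0 ≤ lam) (hlam' : lam ≤ 1) :
    bernoulliMean E p (fun F => if lam * b * p < |(#(D ∩ F) : ℝ) - p * #D| then 1 else 0) ≤
      2 * Real.exp (-(lam ^ 2 * b * p / 4)) := by
  set t : ℝ := lam / 2 with ht
  have ht1 : |t| ≤ 1 := by rw [abs_of_nonneg (by positivity)]; linarith
  have ht2 : |-t| ≤ 1 := by rwa [abs_neg]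
  set s : ℝ := lam * b * p
  have h1 : bernoulliMean E p (fun F => if s < |(#(D ∩ F) : ℝ) - p * #D| then 1 else 0) ≤
      bernoulliMean E p (fun F => Real.exp (-(t * s)) * Real.exp (t * (#(D ∩ F) - p * #D)) +
        Real.exp (-(t * s)) * Real.exp (-t * (#(D ∩ F) - p * #D))) := by
    refine bernoulliMean_mono hp hp' fun F _ => ?_
    rw [← Real.exp_add, ← Real.exp_add]
    have ht0 : 0 ≤ t := by positivity
    split_ifs with h
    · rcases lt_abs.1 h with h | h
      · have : 1 ≤ Real.exp (-(t * s) + t * (#(D ∩ F) - p * #D)) :=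
          Real.one_le_exp (by nlinarith)
        linarith [Real.exp_pos (-(t * s) + -t * (#(D ∩ F) - p * #D))]
      · have : 1 ≤ Real.exp (-(t * s) + -t * (#(D ∩ F) - p * #D)) :=
          Real.one_le_exp (by nlinarith)
        linarith [Real.exp_pos (-(t * s) + t * (#(D ∩ F) - p * #D))]
    · positivity
  refine h1.trans ?_
  rw [bernoulliMean_add, bernoulliMean_const_mul, bernoulliMean_const_mul]
  have h2 := bernoulliMean_exp_le hp hp' hD ht1
  have h3 := bernoulliMean_exp_le hp hp' hD ht2
  rw [neg_sq] at h3
  have h4 : Real.exp (#D * p * t ^ 2) ≤ Real.exp (b * p * t ^ 2) :=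
    Real.exp_le_exp.2 (by gcongr)
  have h5 : Real.exp (-(t * s)) * Real.exp (b * p * t ^ 2) =
      Real.exp (-(lam ^ 2 * b * p / 4)) := by
    rw [← Real.exp_add]
    congr 1
    simp only [ht, s]
    ring
  have h6 := (Real.exp_pos (-(t * s))).le
  have h7 := mul_le_mul_of_nonneg_left (h2.trans h4) h6
  have h8 := mul_le_mul_of_nonneg_left (h3.trans h4) h6
  linarith

end Bernoulli

section Realization

variable {V : Type*} [Fintype V]

theorem IsEDCS.vertexDegree_le {G H : SimpleGraph V} {β β' : ℕ} (h : IsEDCS G H β β') (v : V) :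
    vertexDegree H v ≤ β := by
  classical
  by_cases hv : vertexDegree H v = 0
  · omega
  · rw [vertexDegree_eq_card] at hv
    obtain ⟨w, hw⟩ := card_pos.1 (Nat.pos_of_ne_zero hv)
    have := h.degree_add_le v w (by simpa using hw)
    omega

theorem vertexDegree_mono {H K : SimpleGraph V} (h : H ≤ K) (v : V) :
    vertexDegree H v ≤ vertexDegree K v :=
  Set.ncard_le_ncard (fun _ hw => h hw) (Set.toFinite _)

variable [DecidableEq V]

open MeasureTheory ProbabilityTheory in
theorem expectedMatching_eq_bernoulliMean (G H : SimpleGraph V) [DecidableRel G.Adj]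
    (p : unitInterval) :
    expectedMatching G H p = bernoulliMean G.edgeFinset p
      (fun F => (matchingNumber (H ⊓ SimpleGraph.fromEdgeSet (F : Set (Sym2 V))) : ℝ)) := by
  classical
  have : MeasurableSingletonClass (SimpleGraph V) := ⟨fun K => by
    have h : ({K} : Set (SimpleGraph V)) = SimpleGraph.edgeSet ⁻¹' {K.edgeSet} := by
      ext K'
      simp
    rw [h]
    exact SimpleGraph.measurableEmbedding_edgeSet.measurable (measurableSet_singleton _)⟩
  rw [expectedMatching, realizationLaw,
    integral_map SimpleGraph.measurable_fromEdgeSet.aemeasurable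
      (StronglyMeasurable.of_discrete.aestronglyMeasurable),
    integral_fintype (.of_finite)]
  rw [bernoulliMean]
  symm
  refine Finset.sum_bij_ne_zero (fun F _ _ => (F : Set (Sym2 V))) (fun _ _ _ => mem_univ _)
    (fun _ _ _ _ _ _ h => by exact_mod_cast h) ?_ ?_
  · intro s _ hs
    have hsub : s ⊆ G.edgeSet := by
      by_contra h
      simp [measureReal_def, setBernoulli_singleton_of_not_subset p h] at hs
    refine ⟨s.toFinset, by simpa [Set.subset_def] using hsub, ?_, by simp⟩
    rw [setBernoulli_real_singleton p hsub (Set.toFinite _)] at hs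
    convert hs using 2
    simp only [Set.coe_toFinset, smul_eq_mul]
    congr 3
    · rw [← Set.ncard_coe_finset]; simp
    · rw [← Set.ncard_coe_finset]; simp
  · intro F hF _
    have hsub : (F : Set (Sym2 V)) ⊆ G.edgeSet := fun e he =>
      SimpleGraph.mem_edgeFinset.1 (mem_powerset.1 hF he)
    rw [setBernoulli_real_singleton p hsub (Set.toFinite _)]
    rw [smul_eq_mul]
    congr 3
    · simp
    · rw [← Set.ncard_coe_finset]; simp

/-- The vertices of `B` and their neighbours. -/
noncomputable def closedNeighbors (H : SimpleGraph V) (B : Finset V) : Finset V :=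
  open Classical in B ∪ B.biUnion fun v => univ.filter fun w => H.Adj v w

theorem mem_closedNeighbors {H : SimpleGraph V} {B : Finset V} {w : V} :
    w ∈ closedNeighbors H B ↔ w ∈ B ∨ ∃ v ∈ B, H.Adj v w := by
  simp [closedNeighbors]

theorem card_closedNeighbors_le {H : SimpleGraph V} {β : ℕ} (hβ : ∀ v, vertexDegree H v ≤ β)
    (B : Finset V) : #(closedNeighbors H B) ≤ (1 + β) * #B := by
  classical
  have h : #(B.biUnion fun v => univ.filter fun w => H.Adj v w) ≤ #B * β :=
    card_biUnion_le_card_mul _ _ _ fun v _ => by rw [← vertexDegree_eq_card]; exact hβ v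
  have h2 := card_union_le B (B.biUnion fun v => univ.filter fun w => H.Adj v w)
  have h3 : closedNeighbors H B = B ∪ B.biUnion fun v => univ.filter fun w => H.Adj v w := by
    ext; simp [mem_closedNeighbors]
  rw [h3]
  nlinarith

theorem card_nonisolated_le {H : SimpleGraph V} {β : ℕ} (hβ : ∀ v, vertexDegree H v ≤ β) :
    #(univ.filter fun v => vertexDegree H v ≠ 0) ≤ (1 + β) * (2 * matchingNumber H) := by
  classical
  obtain ⟨f, hf, hc⟩ := exists_isMate_card_covered H
  rw [← hc]
  refine (card_le_card fun v hv => ?_).trans (card_closedNeighbors_le hβ _)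
  simp only [mem_filter, mem_univ, true_and, vertexDegree_eq_card] at hv
  obtain ⟨w, hw⟩ := card_pos.1 (Nat.pos_of_ne_zero hv)
  simp only [mem_filter, mem_univ, true_and] at hw
  rw [mem_closedNeighbors]
  by_cases h : f v = v
  · exact Or.inr ⟨w, mem_covered.2 (hf.covers_of_max hc hw h), hw.symm⟩
  · exact Or.inl (mem_covered.2 h)

/-- The vertices whose degree in the realization `H ⊓ K` is far from its mean. -/
noncomputable def badVertices (H K : SimpleGraph V) (p lam : ℝ) (β : ℕ) : Finset V :=
  open Classical in univ.filter fun v =>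
    lam * β * p < |(vertexDegree (H ⊓ K) v : ℝ) - p * vertexDegree H v|

theorem matchingNumber_realization_le {G H : SimpleGraph V} {β : ℕ}
    (hH : IsEDCS G H β (β - 1)) (K : SimpleGraph V) {p lam : ℝ} (hp : 0 < p) (hp' : p ≤ 1)
    (hlam : 0 < lam) (hlam' : lam ≤ 1 / 500) (hβ : 1 ≤ lam ^ 2 * (p * β)) :
    2 * (matchingNumber (G ⊓ K) : ℝ) ≤ (3 + 80 * lam) * matchingNumber (H ⊓ K) +
      2 * (1 + β) * #(badVertices H K p lam β) := by
  classical
  set B := badVertices H K p lam β with hB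
  set D := closedNeighbors H B with hD
  set H' := avoid (H ⊓ K) B with hH'
  have hgood : ∀ v, v ∉ B →
      |(vertexDegree (H ⊓ K) v : ℝ) - p * vertexDegree H v| ≤ lam * β * p := by
    intro v hv
    simpa [hB, badVertices] using hv
  have hle : ∀ v, (vertexDegree H' v : ℝ) ≤ vertexDegree (H ⊓ K) v := fun v => by
    exact_mod_cast vertexDegree_mono (avoid_le _ _) v
  have heq : ∀ v, v ∉ D → vertexDegree H' v = vertexDegree (H ⊓ K) v := by
    intro v hv
    rw [hD, mem_closedNeighbors] at hv
    push Not at hv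
    unfold vertexDegree
    congr 1
    ext w
    simp only [SimpleGraph.mem_neighborSet]
    exact ⟨fun h => h.1, fun h => ⟨h, hv.1, fun hw => hv.2 w hw h.1.symm⟩⟩
  have hβ0 : (0 : ℝ) ≤ β := by positivity
  have hlp : lam ^ 2 * (p * β) ≤ lam * β := by
    have : lam * p ≤ 1 := by nlinarith
    nlinarith [mul_nonneg hlam.le hβ0]
  obtain ⟨f, hf, hfc⟩ := exists_isMate_card_covered (G ⊓ K)
  let f' : V → V := fun v => if v ∈ D ∨ f v ∈ D then v else f v
  have hf'i : ∀ v, f' (f' v) = v := by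
    intro v
    by_cases h : v ∈ D ∨ f v ∈ D
    · simp [f', h]
    · have h' : ¬ (f v ∈ D ∨ f (f v) ∈ D) := by rw [hf.invol]; tauto
      simp only [f', if_neg h, if_neg h', hf.invol]
  have key := card_covered_le_of_degree_constraints H' hf'i (b := p * β * (1 + 2 * lam))
    (lam := 5 * lam) (by linarith) (by linarith) (by nlinarith)
    (by
      intro u v huv
      have h1 := (abs_le.1 (hgood u huv.2.1)).2
      have h2 := (abs_le.1 (hgood v huv.2.2)).2
      have h3 : (vertexDegree H u + vertexDegree H v : ℝ) ≤ β := by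
        exact_mod_cast hH.degree_add_le u v huv.1.1
      have h4 := mul_le_mul_of_nonneg_left h3 hp.le
      linarith [hle u, hle v])
    (by
      intro v hv
      by_cases h : v ∈ D ∨ f v ∈ D
      · simp [f', h] at hv
      simp only [f', if_neg h] at hv ⊢
      push Not at h
      have hBD : ∀ w, w ∉ D → w ∉ B := fun w hw hwB => hw (mem_closedNeighbors.2 (Or.inl hwB))
      have hadj := hf.adj v hv
      by_cases hHadj : H.Adj v (f v)
      · exact Or.inl ⟨⟨hHadj, hadj.2⟩, hBD _ h.1, hBD _ h.2⟩
      · right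
        rw [heq _ h.1, heq _ h.2]
        have h1 := (abs_le.1 (hgood v (hBD _ h.1))).1
        have h2 := (abs_le.1 (hgood (f v) (hBD _ h.2))).1
        have h3 : (β : ℝ) - 1 ≤ vertexDegree H v + vertexDegree H (f v) := by
          have := hH.le_degree_add v (f v) hadj.1 hHadj
          have : β ≤ vertexDegree H v + vertexDegree H (f v) + 1 := by omega
          have : (β : ℝ) ≤ vertexDegree H v + vertexDegree H (f v) + 1 := by exact_mod_cast this
          linarith
        have h4 := mul_le_mul_of_nonneg_left h3 hp.le
        have h5 : p * 1 ≤ p * (lam * β) := mul_le_mul_of_nonneg_left (by linarith) hp.le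
        have h6 : 0 ≤ p * β * lam ^ 2 := by positivity
        nlinarith)
  have hcov : #(covered f) ≤ #(covered f') + 2 * #D := by
    have hsub : covered f ⊆ covered f' ∪ (D ∪ D.image f) := by
      intro v hv
      simp only [mem_covered] at hv
      simp only [mem_union, mem_covered, mem_image]
      by_cases h1 : v ∈ D
      · exact Or.inr (Or.inl h1)
      · by_cases h2 : f v ∈ D
        · exact Or.inr (Or.inr ⟨f v, h2, hf.invol v⟩)
        · left
          simpa [f', h1, h2] using hv
    have h1 := card_le_card hsub
    have h2 := card_union_le (covered f') (D ∪ D.image f)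
    have h3 := card_union_le D (D.image f)
    have h4 := card_image_le (s := D) (f := f)
    omega
  have hDc := card_closedNeighbors_le hH.vertexDegree_le B
  rw [← hD] at hDc
  have h1 : 2 * matchingNumber (G ⊓ K) ≤ #(covered f') + 2 * ((1 + β) * #B) := by
    rw [← hfc]; omega
  have h2 : 2 * (matchingNumber (G ⊓ K) : ℝ) ≤ #(covered f') + 2 * ((1 + β) * #B) := by
    exact_mod_cast h1
  have h3 : (matchingNumber H' : ℝ) ≤ matchingNumber (H ⊓ K) := by
    exact_mod_cast matchingNumber_mono (avoid_le (H ⊓ K) B)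
  have h4 : (3 + 16 * (5 * lam)) * (matchingNumber H' : ℝ) ≤
      (3 + 16 * (5 * lam)) * matchingNumber (H ⊓ K) :=
    mul_le_mul_of_nonneg_left h3 (by linarith)
  linarith

theorem mul_matchingNumber_le_mean {G H : SimpleGraph V} [DecidableRel G.Adj] (hHG : H ≤ G)
    {p : ℝ} (hp : 0 ≤ p) (hp' : p ≤ 1) :
    p * matchingNumber H ≤ bernoulliMean G.edgeFinset p
      (fun F => (matchingNumber (H ⊓ SimpleGraph.fromEdgeSet (F : Set (Sym2 V))) : ℝ)) := by
  obtain ⟨f, hf, hfc⟩ := exists_isMate_card_covered H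
  have h1 : bernoulliMean G.edgeFinset p
      (fun F => ∑ v ∈ covered f, if s(v, f v) ∈ F then (1 : ℝ) else 0) ≤
      bernoulliMean G.edgeFinset p
      (fun F => 2 * (matchingNumber (H ⊓ SimpleGraph.fromEdgeSet (F : Set (Sym2 V))) : ℝ)) := by
    refine bernoulliMean_mono hp hp' fun F _ => ?_
    let f' : V → V := fun v => if s(v, f v) ∈ F then f v else v
    have hf' : IsMate (H ⊓ SimpleGraph.fromEdgeSet (F : Set (Sym2 V))) f' := by
      constructor
      · intro v
        by_cases h : s(v, f v) ∈ F
        · have h2 : s(f v, f (f v)) ∈ F := by rwa [hf.invol, Sym2.eq_swap]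
          simp only [f', if_pos h, if_pos h2, hf.invol]
        · simp [f', h]
      · intro v hv
        by_cases h : s(v, f v) ∈ F
        · simp only [f', h, if_true] at hv ⊢
          exact ⟨hf.adj v hv, by simpa [h] using hv.symm⟩
        · simp [f', h] at hv
    have h2 := hf'.card_covered_le
    have h3 : covered f' = (covered f).filter fun v => s(v, f v) ∈ F := by
      ext v
      simp only [mem_covered, mem_filter, f']
      split_ifs with h <;> simp [h]
    rw [h3] at h2
    rw [Finset.sum_boole]
    exact_mod_cast h2
  rw [bernoulliMean_sum, bernoulliMean_const_mul] at h1
  have h2 : ∑ v ∈ covered f, bernoulliMean G.edgeFinset p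
      (fun F => if s(v, f v) ∈ F then (1 : ℝ) else 0) = ∑ v ∈ covered f, p := by
    refine sum_congr rfl fun v hv => bernoulliMean_mem ?_
    rw [SimpleGraph.mem_edgeFinset]
    exact hHG (hf.adj v (mem_covered.1 hv))
  rw [h2, sum_const, hfc, nsmul_eq_mul] at h1
  push_cast at h1
  linarith

theorem mean_card_badVertices_le {G H : SimpleGraph V} [DecidableRel G.Adj] {β : ℕ}
    (hH : IsEDCS G H β (β - 1)) {p lam : ℝ} (hp : 0 ≤ p) (hp' : p ≤ 1)
    (hlam : 0 ≤ lam) (hlam' : lam ≤ 1) :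
    bernoulliMean G.edgeFinset p
      (fun F => (#(badVertices H (SimpleGraph.fromEdgeSet (F : Set (Sym2 V))) p lam β) : ℝ)) ≤
      (1 + β) * (2 * matchingNumber H) * (2 * Real.exp (-(lam ^ 2 * β * p / 4))) := by
  classical
  set N : Finset V := univ.filter fun v => vertexDegree H v ≠ 0 with hN
  let D : V → Finset (Sym2 V) := fun v => (univ.filter fun w => H.Adj v w).image fun w => s(v, w)
  have hinj : ∀ v, Function.Injective fun w : V => s(v, w) := fun v a b h => Sym2.congr_right.1 h
  have hDcard : ∀ v, #(D v) = vertexDegree H v := fun v => by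
    rw [vertexDegree_eq_card, card_image_of_injective _ (hinj v)]
  have hDE : ∀ v, D v ⊆ G.edgeFinset := by
    intro v e he
    simp only [D, mem_image, mem_filter, mem_univ, true_and] at he
    obtain ⟨w, hw, rfl⟩ := he
    rw [SimpleGraph.mem_edgeFinset]
    exact hH.le hw
  have hdeg : ∀ v (F : Finset (Sym2 V)),
      vertexDegree (H ⊓ SimpleGraph.fromEdgeSet (F : Set (Sym2 V))) v = #(D v ∩ F) := by
    intro v F
    rw [vertexDegree_eq_card, ← card_image_of_injective _ (hinj v)]
    congr 1
    ext e
    simp only [D, mem_image, mem_filter, mem_univ, true_and, mem_inter, SimpleGraph.inf_adj,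
      SimpleGraph.fromEdgeSet_adj, mem_coe]
    constructor
    · rintro ⟨w, ⟨h1, h2, -⟩, rfl⟩
      exact ⟨⟨w, h1, rfl⟩, h2⟩
    · rintro ⟨⟨w, h1, rfl⟩, h2⟩
      exact ⟨w, ⟨h1, h2, h1.ne⟩, rfl⟩
  have h1 : bernoulliMean G.edgeFinset p
      (fun F => (#(badVertices H (SimpleGraph.fromEdgeSet (F : Set (Sym2 V))) p lam β) : ℝ)) ≤
      bernoulliMean G.edgeFinset p (fun F => ∑ v ∈ N,
        if lam * β * p < |(#(D v ∩ F) : ℝ) - p * #(D v)| then (1 : ℝ) else 0) := by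
    refine bernoulliMean_mono hp hp' fun F _ => ?_
    rw [Finset.sum_boole]
    norm_cast
    refine card_le_card fun v hv => ?_
    simp only [badVertices, mem_filter, mem_univ, true_and, hdeg] at hv
    simp only [hN, mem_filter, mem_univ, true_and, hDcard]
    refine ⟨fun h0 => ?_, hv⟩
    have h2 : #(D v ∩ F) = 0 := by
      have := card_le_card (inter_subset_left : D v ∩ F ⊆ D v)
      rw [hDcard, h0] at this
      omega
    rw [h0, h2] at hv
    have : 0 ≤ lam * β * p := by positivity
    simp at hv
    linarith
  refine h1.trans ?_
  rw [bernoulliMean_sum]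
  have h2 : ∀ v ∈ N, bernoulliMean G.edgeFinset p (fun F =>
      if lam * β * p < |(#(D v ∩ F) : ℝ) - p * #(D v)| then (1 : ℝ) else 0) ≤
      2 * Real.exp (-(lam ^ 2 * β * p / 4)) := fun v _ =>
    bernoulliMean_deviation_le hp hp' (hDE v)
      (by rw [hDcard]; exact_mod_cast hH.vertexDegree_le v) hlam hlam'
  refine (sum_le_sum h2).trans ?_
  rw [sum_const, nsmul_eq_mul]
  refine mul_le_mul_of_nonneg_right ?_ (by positivity)
  exact_mod_cast card_nonisolated_le hH.vertexDegree_le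

/-- An edge-degree constrained subgraph with a large degree bound preserves the expected matching
number of realizations up to a factor `3/2 + O(λ)`. -/
theorem expectedMatching_le_of_isEDCS {G H : SimpleGraph V} {β : ℕ}
    (hH : IsEDCS G H β (β - 1)) {p : unitInterval} {lam : ℝ} (hp : 0 < (p : ℝ))
    (hlam : 0 < lam) (hlam' : lam ≤ 1 / 500) (hβ : 1 ≤ lam ^ 2 * (p * β))
    (htail : 4 * (1 + β : ℝ) ^ 2 * Real.exp (-(lam ^ 2 * β * p / 4)) ≤ lam * p) :
    expectedMatching G G p ≤ (3 / 2 + 41 * lam) * expectedMatching G H p := by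
  classical
  have hp' : (p : ℝ) ≤ 1 := p.2.2
  rw [expectedMatching_eq_bernoulliMean, expectedMatching_eq_bernoulliMean]
  have h1 := bernoulliMean_mono (E := G.edgeFinset) hp.le hp' fun F _ =>
    matchingNumber_realization_le hH (SimpleGraph.fromEdgeSet (F : Set (Sym2 V))) hp hp' hlam
      hlam' hβ
  rw [bernoulliMean_add, bernoulliMean_const_mul, bernoulliMean_const_mul,
    bernoulliMean_const_mul] at h1
  have h2 := mean_card_badVertices_le hH hp.le hp' hlam.le (by linarith : lam ≤ 1)
  have h3 := mul_matchingNumber_le_mean hH.le hp.le hp'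
  set A := bernoulliMean G.edgeFinset p
      (fun F => (matchingNumber (G ⊓ SimpleGraph.fromEdgeSet (F : Set (Sym2 V))) : ℝ))
  set A' := bernoulliMean G.edgeFinset p
      (fun F => (matchingNumber (H ⊓ SimpleGraph.fromEdgeSet (F : Set (Sym2 V))) : ℝ))
  set x := Real.exp (-(lam ^ 2 * β * p / 4))
  have h4 : 2 * (1 + β : ℝ) * ((1 + β) * (2 * matchingNumber H) * (2 * x)) ≤
      2 * lam * (p * matchingNumber H) := by
    have := mul_le_mul_of_nonneg_right htail (by positivity : (0 : ℝ) ≤ 2 * matchingNumber H)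
    linarith
  have h5 := mul_le_mul_of_nonneg_left h2 (by positivity : (0 : ℝ) ≤ 2 * (1 + β))
  have h6 := mul_le_mul_of_nonneg_left h3 (by positivity : (0 : ℝ) ≤ 2 * lam)
  linarith

end Realization

/-! ### Reasoning about programs -/

namespace RAM

section

variable (σ : Mem) (r x a i : ℕ)

@[simp] theorem Mem.setReg_reg (s : ℕ) :
    (σ.setReg r x).reg s = if s = r then x else σ.reg s := by
  simp [Mem.setReg, Function.update_apply]

@[simp] theorem Mem.setReg_arr : (σ.setReg r x).arr = σ.arr := rfl

@[simp] theorem Mem.setArr_reg : (σ.setArr a i x).reg = σ.reg := rfl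

@[simp] theorem Mem.setArr_arr (b j : ℕ) :
    (σ.setArr a i x).arr b j = if b = a ∧ j = i then x else σ.arr b j := by
  by_cases hb : b = a
  · subst hb
    by_cases hj : j = i <;> simp [Mem.setArr, hj]
  · simp [Mem.setArr, hb]

end

/-- The program contains no loop. -/
def Prog.LoopFree : Prog → Prop
  | .seq P Q => P.LoopFree ∧ Q.LoopFree
  | .ite _ P Q => P.LoopFree ∧ Q.LoopFree
  | .while _ _ => False
  | _ => True

/-- The result of a loop-free program. -/
def Prog.run : Prog → Mem → Mem
  | .const r k, σ => σ.setReg r k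
  | .add r s t, σ => σ.setReg r (σ.reg s + σ.reg t)
  | .sub r s t, σ => σ.setReg r (σ.reg s - σ.reg t)
  | .load r a i, σ => σ.setReg r (σ.arr a (σ.reg i))
  | .store a i s, σ => σ.setArr a (σ.reg i) (σ.reg s)
  | .seq P Q, σ => Q.run (P.run σ)
  | .ite r P Q, σ => if σ.reg r ≠ 0 then P.run σ else Q.run σ
  | .while _ _, σ => σ

/-- An upper bound for the number of steps of a loop-free program. -/
def Prog.cost : Prog → ℕ
  | .seq P Q => P.cost + Q.cost
  | .ite _ P Q => P.cost + Q.cost + 1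
  | _ => 1

theorem Prog.LoopFree.exec {P : Prog} (hP : P.LoopFree) (σ : Mem) :
    ∃ t, Exec P σ t (P.run σ) ∧ t ≤ P.cost := by
  induction P generalizing σ with
  | const r k => exact ⟨1, .const .., le_rfl⟩
  | add r s t => exact ⟨1, .add .., le_rfl⟩
  | sub r s t => exact ⟨1, .sub .., le_rfl⟩
  | load r a i => exact ⟨1, .load .., le_rfl⟩
  | store a i s => exact ⟨1, .store .., le_rfl⟩
  | seq P Q ihP ihQ =>
    obtain ⟨t, h, ht⟩ := ihP hP.1 σ
    obtain ⟨t', h', ht'⟩ := ihQ hP.2 (P.run σ)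
    exact ⟨t + t', .seq h h', add_le_add ht ht'⟩
  | ite r P Q ihP ihQ =>
    by_cases hr : σ.reg r = 0
    · obtain ⟨t, h, ht⟩ := ihQ hP.2 σ
      refine ⟨t + 1, ?_, by simp only [Prog.cost]; omega⟩
      simpa [Prog.run, hr] using Exec.ite_false hr h
    · obtain ⟨t, h, ht⟩ := ihP hP.1 σ
      refine ⟨t + 1, ?_, by simp only [Prog.cost]; omega⟩
      simpa [Prog.run, hr] using Exec.ite_true hr h
  | _ r P => exact hP.elim

/-- A loop with a loop-free body whose condition stays true for exactly `k` rounds. -/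
theorem Exec.while_iterate {P : Prog} (hP : P.LoopFree) {r k : ℕ} {σ : Mem}
    (hlt : ∀ j < k, (P.run^[j] σ).reg r ≠ 0) (hk : (P.run^[k] σ).reg r = 0) :
    ∃ t, Exec (.while r P) σ t (P.run^[k] σ) ∧ t ≤ k * (P.cost + 1) + 1 := by
  induction k generalizing σ with
  | zero => exact ⟨1, .while_false hk, by omega⟩
  | succ k ih =>
    obtain ⟨t, h, ht⟩ := hP.exec σ
    obtain ⟨t', h', ht'⟩ := ih (σ := P.run σ) (fun j hj => hlt (j + 1) (by omega)) hk
    refine ⟨t + t' + 1, .while_true (hlt 0 (by omega)) h h', ?_⟩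
    rw [add_mul]
    omega

/-- A loop with a loop-free body, an invariant and a decreasing measure. -/
theorem Exec.while_measure {P : Prog} (hP : P.LoopFree) {r : ℕ} {I : ℕ → Mem → Prop}
    (hstep : ∀ k σ, I k σ → σ.reg r ≠ 0 → ∃ k' < k, I k' (P.run σ)) (k : ℕ) :
    ∀ σ, I k σ → ∃ t τ k', Exec (.while r P) σ t τ ∧ t ≤ k * (P.cost + 1) + 1 ∧
      I k' τ ∧ τ.reg r = 0 := by
  induction k using Nat.strong_induction_on with
  | _ k ih =>
  intro σ hσ
  by_cases hr : σ.reg r = 0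
  · exact ⟨1, σ, k, .while_false hr, by omega, hσ, hr⟩
  · obtain ⟨k', hk', hI⟩ := hstep k σ hσ hr
    obtain ⟨t, h, ht⟩ := hP.exec σ
    obtain ⟨t', τ, k'', h', ht', hI', hr'⟩ := ih k' hk' _ hI
    refine ⟨t + t' + 1, τ, k'', .while_true hr h h', ?_, hI', hr'⟩
    have : (k' + 1) * (P.cost + 1) ≤ k * (P.cost + 1) := Nat.mul_le_mul_right _ hk'
    rw [add_mul] at this
    omega

/-! ### The degree bound -/

/-- The least `a` with `y ≤ x * 2 ^ a`. -/
noncomputable def doublings (x y : ℕ) : ℕ := sInf {a | y ≤ x * 2 ^ a}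

theorem doublings_nonempty {x : ℕ} (hx : 0 < x) (y : ℕ) : y.size ∈ {a | y ≤ x * 2 ^ a} :=
  (Nat.lt_size_self y).le.trans (Nat.le_mul_of_pos_left _ hx)

theorem le_mul_two_pow_doublings {x : ℕ} (hx : 0 < x) (y : ℕ) : y ≤ x * 2 ^ doublings x y :=
  Nat.sInf_mem ⟨_, doublings_nonempty hx y⟩

theorem doublings_le_size {x : ℕ} (hx : 0 < x) (y : ℕ) : doublings x y ≤ y.size :=
  Nat.sInf_le (doublings_nonempty hx y)

theorem mul_two_pow_lt_of_lt_doublings {x y j : ℕ} (hj : j < doublings x y) : x * 2 ^ j < y :=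
  not_le.1 fun h => Nat.notMem_of_lt_sInf hj h

/-- The degree bound with leading constant `K`, for rational parameters `ε` and `p`. -/
noncomputable def degreeBound (K : ℕ) (ε p : ℚ) : ℕ :=
  (doublings ε.num.toNat ε.den + doublings p.num.toNat p.den) *
    (K * 4 ^ doublings ε.num.toNat ε.den * 2 ^ doublings p.num.toNat p.den)

/-- `R5 := K`, `R8 := 1`, `R7 := R2 - R1`. -/
def initProg (K : ℕ) : Prog := .seq (.const 8 1) (.seq (.const 5 K) (.sub 7 2 1))

/-- `R1 := 2 * R1`, `R5 := 4 * R5`, `R6 := R6 + 1`, `R7 := R2 - R1`. -/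
def scaleEpsBody : Prog :=
  .seq (.add 1 1 1) (.seq (.add 5 5 5) (.seq (.add 5 5 5) (.seq (.add 6 6 8) (.sub 7 2 1))))

/-- `R3 := 2 * R3`, `R5 := 2 * R5`, `R6 := R6 + 1`, `R7 := R4 - R3`. -/
def scaleProbBody : Prog :=
  .seq (.add 3 3 3) (.seq (.add 5 5 5) (.seq (.add 6 6 8) (.sub 7 4 3)))

/-- `R9 := R9 + R5`, `R6 := R6 - 1`. -/
def multiplyBody : Prog := .seq (.add 9 9 5) (.sub 6 6 8)

/-- `R9 := min R9 (2 * R0)`, `R15 := R0 - R11`. -/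
def capProg : Prog :=
  .seq (.add 10 0 0) (.seq (.sub 7 9 10) (.seq (.sub 9 9 7) (.sub 15 0 11)))

/-- Compute the minimum of the degree bound and `2 * R0` in `R9`. -/
def boundProg (K : ℕ) : Prog :=
  .seq (initProg K) (.seq (.while 7 scaleEpsBody) (.seq (.sub 7 4 3)
    (.seq (.while 7 scaleProbBody) (.seq (.while 6 multiplyBody) capProg))))

theorem scaleEpsBody_iterate {σ : Mem} (h8 : σ.reg 8 = 1) (h7 : σ.reg 7 = σ.reg 2 - σ.reg 1)
    (j : ℕ) : (scaleEpsBody.run^[j] σ).reg = fun r =>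
      if r = 1 then σ.reg 1 * 2 ^ j else if r = 5 then σ.reg 5 * 4 ^ j
      else if r = 6 then σ.reg 6 + j else if r = 7 then σ.reg 2 - σ.reg 1 * 2 ^ j
      else σ.reg r := by
  induction j with
  | zero => funext r; simp; grind
  | succ j ih =>
    rw [Function.iterate_succ_apply']
    generalize scaleEpsBody.run^[j] σ = τ at ih ⊢
    funext r
    simp only [scaleEpsBody, Prog.run, Mem.setReg_reg, ih]
    have e1 : σ.reg 1 * 2 ^ (j + 1) = σ.reg 1 * 2 ^ j + σ.reg 1 * 2 ^ j := by ring
    have e2 : σ.reg 5 * 4 ^ (j + 1) =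
      σ.reg 5 * 4 ^ j + σ.reg 5 * 4 ^ j + (σ.reg 5 * 4 ^ j + σ.reg 5 * 4 ^ j) := by ring
    rw [e1, e2]
    simp [h8]
    grind

theorem scaleProbBody_iterate {σ : Mem} (h8 : σ.reg 8 = 1) (h7 : σ.reg 7 = σ.reg 4 - σ.reg 3)
    (j : ℕ) : (scaleProbBody.run^[j] σ).reg = fun r =>
      if r = 3 then σ.reg 3 * 2 ^ j else if r = 5 then σ.reg 5 * 2 ^ j
      else if r = 6 then σ.reg 6 + j else if r = 7 then σ.reg 4 - σ.reg 3 * 2 ^ j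
      else σ.reg r := by
  induction j with
  | zero => funext r; simp; grind
  | succ j ih =>
    rw [Function.iterate_succ_apply']
    generalize scaleProbBody.run^[j] σ = τ at ih ⊢
    funext r
    simp only [scaleProbBody, Prog.run, Mem.setReg_reg, ih]
    have e1 : σ.reg 3 * 2 ^ (j + 1) = σ.reg 3 * 2 ^ j + σ.reg 3 * 2 ^ j := by ring
    have e2 : σ.reg 5 * 2 ^ (j + 1) = σ.reg 5 * 2 ^ j + σ.reg 5 * 2 ^ j := by ring
    rw [e1, e2]
    simp [h8]
    grind

theorem multiplyBody_iterate {σ : Mem} (h8 : σ.reg 8 = 1) (j : ℕ) :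
    (multiplyBody.run^[j] σ).reg = fun r =>
      if r = 9 then σ.reg 9 + j * σ.reg 5 else if r = 6 then σ.reg 6 - j else σ.reg r := by
  induction j with
  | zero => funext r; simp; grind
  | succ j ih =>
    rw [Function.iterate_succ_apply']
    generalize multiplyBody.run^[j] σ = τ at ih ⊢
    funext r
    simp only [multiplyBody, Prog.run, Mem.setReg_reg, ih]
    have e1 : σ.reg 9 + (j + 1) * σ.reg 5 = σ.reg 9 + j * σ.reg 5 + σ.reg 5 := by ring
    rw [e1]
    simp [h8]
    grind

theorem iterate_run_arr {P : Prog} (hP : ∀ σ, (P.run σ).arr = σ.arr) (j : ℕ) (σ : Mem) :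
    (P.run^[j] σ).arr = σ.arr := by
  induction j with
  | zero => rfl
  | succ j ih => rw [Function.iterate_succ_apply', hP, ih]

theorem boundProg_exec (K : ℕ) {σ : Mem} (h1 : 0 < σ.reg 1) (h3 : 0 < σ.reg 3)
    (h0 : ∀ r, 4 < r → σ.reg r = 0) :
    ∃ t τ, Exec (boundProg K) σ t τ ∧ t ≤ 30 * ((σ.reg 2).size + (σ.reg 4).size + 1) ∧
      τ.arr = σ.arr ∧ τ.reg 0 = σ.reg 0 ∧ τ.reg 8 = 1 ∧
      τ.reg 9 = min ((doublings (σ.reg 1) (σ.reg 2) + doublings (σ.reg 3) (σ.reg 4)) *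
        (K * 4 ^ doublings (σ.reg 1) (σ.reg 2) * 2 ^ doublings (σ.reg 3) (σ.reg 4)))
        (2 * σ.reg 0) ∧
      τ.reg 15 = σ.reg 0 ∧ ∀ r, 15 ≠ r → 10 < r → τ.reg r = 0 := by
  set a := doublings (σ.reg 1) (σ.reg 2) with ha
  set b := doublings (σ.reg 3) (σ.reg 4) with hb
  obtain ⟨t₁, e₁, ht₁⟩ := (show (initProg K).LoopFree from ⟨trivial, trivial, trivial⟩).exec σ
  set σ₁ := (initProg K).run σ with hσ₁
  have r₁ : σ₁.reg = fun r => if r = 7 then σ.reg 2 - σ.reg 1 else if r = 5 then K else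
      if r = 8 then 1 else σ.reg r := by
    funext r
    simp [hσ₁, initProg, Prog.run]
  have hsE := scaleEpsBody_iterate (σ := σ₁) (by simp [r₁]) (by simp [r₁])
  obtain ⟨t₂, e₂, ht₂⟩ := Exec.while_iterate (P := scaleEpsBody) (r := 7) (k := a) (σ := σ₁)
    ⟨trivial, trivial, trivial, trivial, trivial⟩
    (fun j hj => by
      have := mul_two_pow_lt_of_lt_doublings hj
      simp [hsE, r₁]
      omega)
    (by
      have := le_mul_two_pow_doublings h1 (σ.reg 2)
      rw [← ha] at this
      simp [hsE, r₁]
      omega)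
  set σ₂ := scaleEpsBody.run^[a] σ₁ with hσ₂
  have r₂ : σ₂.reg = _ := hsE a
  set σ₃ := (Prog.sub 7 4 3).run σ₂ with hσ₃
  have r₃ : σ₃.reg = fun r => if r = 7 then σ.reg 4 - σ.reg 3 else if r = 1 then σ.reg 1 * 2 ^ a
      else if r = 5 then K * 4 ^ a else if r = 6 then a else if r = 8 then 1 else σ.reg r := by
    funext r
    simp only [hσ₃, Prog.run, Mem.setReg_reg, r₂, r₁]
    have := h0 6 (by omega)
    simp [this]
    grind
  have hsP := scaleProbBody_iterate (σ := σ₃) (by simp [r₃]) (by simp [r₃])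
  obtain ⟨t₄, e₄, ht₄⟩ := Exec.while_iterate (P := scaleProbBody) (r := 7) (k := b) (σ := σ₃)
    ⟨trivial, trivial, trivial, trivial⟩
    (fun j hj => by
      have := mul_two_pow_lt_of_lt_doublings hj
      simp [hsP, r₃]
      omega)
    (by
      have := le_mul_two_pow_doublings h3 (σ.reg 4)
      rw [← hb] at this
      simp [hsP, r₃]
      omega)
  set σ₄ := scaleProbBody.run^[b] σ₃ with hσ₄
  have r₄' : σ₄.reg = _ := hsP b
  have r₄ : σ₄.reg 6 = a + b ∧ σ₄.reg 5 = K * 4 ^ a * 2 ^ b ∧ σ₄.reg 8 = 1 ∧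
      σ₄.reg 0 = σ.reg 0 ∧ ∀ r, 8 < r → σ₄.reg r = 0 := by
    simp only [r₄', r₃]
    refine ⟨by simp, by simp, by simp, by simp, fun r hr => ?_⟩
    have := h0 r (by omega)
    grind
  have hsM := multiplyBody_iterate (σ := σ₄) r₄.2.2.1
  obtain ⟨t₅, e₅, ht₅⟩ := Exec.while_iterate (P := multiplyBody) (r := 6) (k := a + b) (σ := σ₄)
    ⟨trivial, trivial⟩
    (fun j hj => by simp [hsM, r₄.1]; omega)
    (by simp [hsM, r₄.1])
  set σ₅ := multiplyBody.run^[a + b] σ₄ with hσ₅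
  have r₅ : σ₅.reg = _ := hsM (a + b)
  obtain ⟨t₆, e₆, ht₆⟩ :=
    (show capProg.LoopFree from ⟨trivial, trivial, trivial, trivial⟩).exec σ₅
  refine ⟨_, _, .seq e₁ (.seq e₂ (.seq (.sub 7 4 3 σ₂) (.seq e₄ (.seq e₅ e₆)))), ?_, ?_, ?_⟩
  · have ha' : a ≤ (σ.reg 2).size := doublings_le_size h1 _
    have hb' : b ≤ (σ.reg 4).size := doublings_le_size h3 _
    simp only [initProg, scaleEpsBody, scaleProbBody, multiplyBody, capProg, Prog.cost] at *
    omega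
  · have : (capProg.run σ₅).arr = σ₅.arr := rfl
    rw [this, hσ₅, iterate_run_arr (fun _ => rfl), hσ₄, iterate_run_arr (fun _ => rfl), hσ₃]
    change σ₂.arr = _
    rw [hσ₂, iterate_run_arr (fun _ => rfl)]
    rfl
  · simp only [capProg, Prog.run, Mem.setReg_reg, r₅]
    obtain ⟨q6, q5, q8, q0, q⟩ := r₄
    refine ⟨by simp [q0], by simp [q8], ?_, ?_, fun r hr hr' => ?_⟩
    · simp [q0, q5, q 9]
      omega
    · simp [q0, q 11]
    · have := q r (by omega)
      grind

end RAM

/-! ### Local search for edge-degree constrained subgraphs -/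

section LocalSearch

variable {n : ℕ}

theorem vertexDegree_sup_edge {H : SimpleGraph (Fin n)} {u v : Fin n} (huv : u ≠ v)
    (h : ¬ H.Adj u v) (w : Fin n) :
    vertexDegree (H ⊔ SimpleGraph.edge u v) w =
      vertexDegree H w + if w = u ∨ w = v then 1 else 0 := by
  have h' : ¬ H.Adj v u := fun hh => h hh.symm
  unfold vertexDegree
  by_cases hu : w = u
  · subst hu
    have : (H ⊔ SimpleGraph.edge w v).neighborSet w = insert v (H.neighborSet w) := by
      ext x
      simp only [SimpleGraph.mem_neighborSet, SimpleGraph.sup_adj, SimpleGraph.edge_adj,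
        Set.mem_insert_iff]
      grind
    rw [this, Set.ncard_insert_of_notMem (by simpa using h) (Set.toFinite _)]
    simp
  by_cases hv : w = v
  · subst hv
    have : (H ⊔ SimpleGraph.edge u w).neighborSet w = insert u (H.neighborSet w) := by
      ext x
      simp only [SimpleGraph.mem_neighborSet, SimpleGraph.sup_adj, SimpleGraph.edge_adj,
        Set.mem_insert_iff]
      grind
    rw [this, Set.ncard_insert_of_notMem (by simpa using h') (Set.toFinite _)]
    simp
  · have : (H ⊔ SimpleGraph.edge u v).neighborSet w = H.neighborSet w := by
      ext x
      simp only [SimpleGraph.mem_neighborSet, SimpleGraph.sup_adj, SimpleGraph.edge_adj]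
      grind
    rw [this]
    simp [hu, hv]

theorem sdiff_edge_sup_edge {H : SimpleGraph (Fin n)} {u v : Fin n} (h : H.Adj u v) :
    (H \ SimpleGraph.edge u v) ⊔ SimpleGraph.edge u v = H := by
  have : SimpleGraph.edge u v ≤ H := by
    rw [SimpleGraph.edge_le_iff]
    exact Or.inr h
  exact sdiff_sup_cancel this

theorem not_sdiff_edge_adj {H : SimpleGraph (Fin n)} {u v : Fin n} (huv : u ≠ v) :
    ¬ (H \ SimpleGraph.edge u v).Adj u v := by
  simp [SimpleGraph.sdiff_adj, SimpleGraph.edge_adj, huv]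

/-- The potential that increases with each step of the local search. -/
noncomputable def potential (b : ℕ) (H : SimpleGraph (Fin n)) : ℤ :=
  ∑ w, ((2 * b - 1) * (vertexDegree H w : ℤ) - 2 * (vertexDegree H w : ℤ) ^ 2)

theorem potential_sup_edge (b : ℕ) {H : SimpleGraph (Fin n)} {u v : Fin n} (huv : u ≠ v)
    (h : ¬ H.Adj u v) : potential b (H ⊔ SimpleGraph.edge u v) = potential b H +
      (4 * b - 6 - 4 * (vertexDegree H u + vertexDegree H v)) := by
  rw [← sub_eq_iff_eq_add', potential, potential, ← sum_sub_distrib,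
    Fintype.sum_eq_add u v huv]
  · simp only [vertexDegree_sup_edge huv h]
    simp
    ring
  · rintro w ⟨hu, hv⟩
    simp [vertexDegree_sup_edge huv h, hu, hv]

theorem vertexDegree_lt (H : SimpleGraph (Fin n)) (v : Fin n) : vertexDegree H v < n := by
  classical
  have h : #(univ.filter fun w => H.Adj v w) < #(univ : Finset (Fin n)) :=
    card_lt_card ⟨subset_univ _, fun h => by simpa using h (mem_univ v)⟩
  rw [vertexDegree_eq_card]
  simpa using h

theorem potential_le {b : ℕ} (hb : b ≤ 2 * n) (H : SimpleGraph (Fin n)) :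
    potential b H ≤ 4 * n ^ 3 := by
  have h : ∀ w ∈ (univ : Finset (Fin n)), (2 * b - 1) * (vertexDegree H w : ℤ) -
      2 * (vertexDegree H w : ℤ) ^ 2 ≤ 4 * n ^ 2 := by
    intro w _
    have h1 : (vertexDegree H w : ℤ) ≤ n := by exact_mod_cast (vertexDegree_lt H w).le
    have h2 : (b : ℤ) ≤ 2 * n := by exact_mod_cast hb
    have h3 : (0 : ℤ) ≤ vertexDegree H w := by positivity
    have h4 : (b : ℤ) * vertexDegree H w ≤ (2 * n) * n := by gcongr
    nlinarith
  refine (sum_le_sum h).trans ?_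
  simp
  ring_nf
  rfl

theorem potential_bot (b : ℕ) : potential b (⊥ : SimpleGraph (Fin n)) = 0 := by
  simp [potential, vertexDegree, SimpleGraph.neighborSet]

/-- The pair `uv` meets the constraints of an `EDCS(G, b, b - 1)`. -/
def PairOk (G H : SimpleGraph (Fin n)) (b : ℕ) (u v : Fin n) : Prop :=
  (H.Adj u v → vertexDegree H u + vertexDegree H v ≤ b) ∧
    (G.Adj u v → ¬ H.Adj u v → b ≤ vertexDegree H u + vertexDegree H v + 1)

theorem isEDCS_of_pairOk {G H : SimpleGraph (Fin n)} {β : ℕ} (hle : H ≤ G)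
    (h : ∀ u v, PairOk G H (min β (2 * n)) u v) : IsEDCS G H β (β - 1) := by
  refine ⟨hle, fun u v huv => ((h u v).1 huv).trans (min_le_left _ _), fun u v hG hH => ?_⟩
  have h1 := (h u v).2 hG hH
  have h2 := vertexDegree_lt H u
  have h3 := vertexDegree_lt H v
  omega

end LocalSearch

namespace RAM

/-- Start the scan of the pairs anew. -/
def resetProg : Prog := .seq (.const 11 0) (.seq (.const 12 0) (.seq (.const 13 0) (.const 14 0)))

/-- Go to the next pair. -/
def advanceProg : Prog :=
  .seq (.add 12 12 8) (.seq (.add 13 13 8) (.seq (.add 14 14 0) (.seq (.sub 21 0 12)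
    (.ite 21 (.const 21 0) (.seq (.const 12 0) (.seq (.add 11 11 8) (.add 14 11 22)))))))

/-- Remove the current pair from the subgraph. -/
def removeProg : Prog :=
  .seq (.store 1 13 22) (.seq (.store 1 14 22) (.seq (.sub 18 18 8) (.seq (.sub 19 19 8)
    (.seq (.store 2 11 18) (.seq (.store 2 12 19) resetProg)))))

/-- Add the current pair to the subgraph. -/
def insertProg : Prog :=
  .seq (.store 1 13 8) (.seq (.store 1 14 8) (.seq (.add 18 18 8) (.seq (.add 19 19 8)
    (.seq (.store 2 11 18) (.seq (.store 2 12 19) resetProg)))))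

/-- Read the current pair and the degrees of its ends. -/
def loadProg : Prog :=
  .seq (.load 16 0 13) (.seq (.load 17 1 13) (.seq (.load 18 2 11) (.seq (.load 19 2 12)
    (.add 20 18 19))))

/-- Treat the current pair. -/
def actProg : Prog :=
  .ite 17
    (.seq (.sub 21 20 9) (.ite 21 removeProg advanceProg))
    (.ite 16
      (.seq (.add 21 20 8) (.seq (.sub 21 9 21) (.ite 21 insertProg advanceProg)))
      advanceProg)

/-- One step of the local search. -/
def searchBody : Prog := .seq loadProg (.seq actProg (.sub 15 0 11))

/-- The local search for a subgraph with the degree bound in `R9`. -/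
def searchProg : Prog := .while 15 searchBody

variable {n : ℕ}

/-- The memory during the local search, with current subgraph `H` and current pair `uv`. -/
structure Searching (G : SimpleGraph (Fin n)) (b : ℕ) (H : SimpleGraph (Fin n)) (u v : ℕ)
    (σ : Mem) : Prop where
  size : σ.reg 0 = n
  one : σ.reg 8 = 1
  bound : σ.reg 9 = b
  zero : σ.reg 22 = 0
  row : σ.reg 11 = u
  col : σ.reg 12 = v
  index : σ.reg 13 = u * n + v
  transposed : σ.reg 14 = v * n + u
  input : σ.HoldsGraph 0 G
  output : σ.HoldsGraph 1 H
  degree : ∀ w : Fin n, σ.arr 2 w = vertexDegree H w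

theorem index_inj {u v x y : Fin n} : (x : ℕ) * n + y = u * n + v ↔ x = u ∧ y = v := by
  constructor
  · intro h
    have hn : 0 < n := lt_of_le_of_lt (Nat.zero_le _) u.2
    have h1 : (x : ℕ) = u := by
      have := congrArg (· / n) h
      simpa [Nat.mul_comm _ n, Nat.mul_add_div hn, Nat.div_eq_of_lt] using this
    have h2 : (y : ℕ) = v := by rw [h1] at h; omega
    exact ⟨Fin.ext h1, Fin.ext h2⟩
  · rintro ⟨rfl, rfl⟩; rfl

section

variable {G H : SimpleGraph (Fin n)} {b : ℕ} {σ : Mem}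

theorem Searching.load {u v : ℕ} (h : Searching G b H u v σ) :
    Searching G b H u v (loadProg.run σ) ∧
      (loadProg.run σ).reg 16 = σ.arr 0 (u * n + v) ∧
      (loadProg.run σ).reg 17 = σ.arr 1 (u * n + v) ∧
      (loadProg.run σ).reg 18 = σ.arr 2 u ∧ (loadProg.run σ).reg 19 = σ.arr 2 v ∧
      (loadProg.run σ).reg 20 = σ.arr 2 u + σ.arr 2 v := by
  obtain ⟨h0, h8, h9, h22, h11, h12, h13, h14, hG, hH, hd⟩ := h
  have harr : (loadProg.run σ).arr = σ.arr := rfl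
  refine ⟨⟨?_, ?_, ?_, ?_, ?_, ?_, ?_, ?_, hG, hH, hd⟩, ?_⟩ <;>
    simp [loadProg, Prog.run, *]

theorem Searching.setReg {u v r x : ℕ} (h : Searching G b H u v σ) (hr : r = 15 ∨ r = 21) :
    Searching G b H u v (σ.setReg r x) := by
  obtain ⟨h0, h8, h9, h22, h11, h12, h13, h14, hG, hH, hd⟩ := h
  refine ⟨?_, ?_, ?_, ?_, ?_, ?_, ?_, ?_, hG, hH, hd⟩ <;>
    rcases hr with rfl | rfl <;> simp [*]

theorem Searching.advance {u v : ℕ} (h : Searching G b H u v σ) (hv : v < n) :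
    Searching G b H (if v + 1 < n then u else u + 1) (if v + 1 < n then v + 1 else 0)
      (advanceProg.run σ) := by
  obtain ⟨h0, h8, h9, h22, h11, h12, h13, h14, hG, hH, hd⟩ := h
  have harr : (advanceProg.run σ).arr = σ.arr := by
    simp [advanceProg, Prog.run, apply_ite Mem.arr]
  have hG' : (advanceProg.run σ).HoldsGraph 0 G := by unfold Mem.HoldsGraph; rw [harr]; exact hG
  have hH' : (advanceProg.run σ).HoldsGraph 1 H := by unfold Mem.HoldsGraph; rw [harr]; exact hH
  have hd' : ∀ w : Fin n, (advanceProg.run σ).arr 2 w = vertexDegree H w := by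
    rw [harr]; exact hd
  by_cases hv' : v + 1 < n
  · have hne : n - (v + 1) ≠ 0 := by omega
    simp only [hv', if_true]
    refine ⟨?_, ?_, ?_, ?_, ?_, ?_, ?_, ?_, hG', hH', hd'⟩ <;>
      simp [advanceProg, Prog.run, *] <;> ring
  · have hne : n - (v + 1) = 0 := by omega
    have hvn : v + 1 = n := by omega
    simp only [hv', if_false]
    refine ⟨?_, ?_, ?_, ?_, ?_, ?_, ?_, ?_, hG', hH', hd'⟩ <;>
      simp [advanceProg, Prog.run, *]
    rw [add_assoc, hvn]
    ring

theorem Searching.insert {u v : Fin n} (h : Searching G b H u v σ) (huv : u ≠ v)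
    (hadj : ¬ H.Adj u v) (h18 : σ.reg 18 = vertexDegree H u) (h19 : σ.reg 19 = vertexDegree H v) :
    Searching G b (H ⊔ SimpleGraph.edge u v) 0 0 (insertProg.run σ) := by
  obtain ⟨h0, h8, h9, h22, h11, h12, h13, h14, hG, hH, hd⟩ := h
  refine ⟨?_, ?_, ?_, ?_, ?_, ?_, ?_, ?_, ?_, ?_, ?_⟩
  · simp [insertProg, resetProg, Prog.run, *]
  · simp [insertProg, resetProg, Prog.run, *]
  · simp [insertProg, resetProg, Prog.run, *]
  · simp [insertProg, resetProg, Prog.run, *]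
  · simp [insertProg, resetProg, Prog.run, *]
  · simp [insertProg, resetProg, Prog.run, *]
  · simp [insertProg, resetProg, Prog.run, *]
  · simp [insertProg, resetProg, Prog.run, *]
  · intro x y
    simpa [insertProg, resetProg, Prog.run] using hG x y
  · intro x y
    have := hH x y
    simp [insertProg, resetProg, Prog.run, h13, h14, h8, index_inj, SimpleGraph.edge_adj]
    grind
  · intro w
    rw [vertexDegree_sup_edge huv hadj]
    simp [insertProg, resetProg, Prog.run, h11, h12, h8, h18, h19, hd, ← Fin.ext_iff]
    grind

theorem Searching.remove {u v : Fin n} (h : Searching G b H u v σ)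
    (hadj : H.Adj u v) (h18 : σ.reg 18 = vertexDegree H u) (h19 : σ.reg 19 = vertexDegree H v) :
    Searching G b (H \ SimpleGraph.edge u v) 0 0 (removeProg.run σ) := by
  obtain ⟨h0, h8, h9, h22, h11, h12, h13, h14, hG, hH, hd⟩ := h
  have huv := hadj.ne
  have hdeg := vertexDegree_sup_edge (H := H \ SimpleGraph.edge u v) huv (not_sdiff_edge_adj huv)
  rw [sdiff_edge_sup_edge hadj] at hdeg
  refine ⟨?_, ?_, ?_, ?_, ?_, ?_, ?_, ?_, ?_, ?_, ?_⟩
  · simp [removeProg, resetProg, Prog.run, *]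
  · simp [removeProg, resetProg, Prog.run, *]
  · simp [removeProg, resetProg, Prog.run, *]
  · simp [removeProg, resetProg, Prog.run, *]
  · simp [removeProg, resetProg, Prog.run, *]
  · simp [removeProg, resetProg, Prog.run, *]
  · simp [removeProg, resetProg, Prog.run, *]
  · simp [removeProg, resetProg, Prog.run, *]
  · intro x y
    simpa [removeProg, resetProg, Prog.run] using hG x y
  · intro x y
    have := hH x y
    simp [removeProg, resetProg, Prog.run, h13, h14, h22, index_inj, SimpleGraph.edge_adj]
    grind
  · intro w
    have := hdeg w
    simp [removeProg, resetProg, Prog.run, h11, h12, h8, h18, h19, hd, ← Fin.ext_iff]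
    grind

end

end RAM

namespace RAM

variable {n : ℕ} {G H : SimpleGraph (Fin n)} {b : ℕ} {σ : Mem}

theorem Mem.HoldsGraph.arr_ne_zero_iff {a : ℕ} (h : σ.HoldsGraph a G) (u v : Fin n) :
    σ.arr a (u * n + v) ≠ 0 ↔ G.Adj u v := by
  have := h u v
  by_cases hG : G.Adj u v
  · simp [this.1 hG, hG]
  · simp [this.2 hG, hG]

/-- One step of the local search either removes an edge of too large degree sum, or inserts an
edge of too small degree sum, or goes on to the next pair. -/
theorem Searching.act {u v : Fin n} (h : Searching G b H u v σ) :
    (H.Adj u v ∧ b < vertexDegree H u + vertexDegree H v ∧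
      Searching G b (H \ SimpleGraph.edge u v) 0 0 (actProg.run (loadProg.run σ))) ∨
    (¬ H.Adj u v ∧ G.Adj u v ∧ vertexDegree H u + vertexDegree H v + 1 < b ∧
      Searching G b (H ⊔ SimpleGraph.edge u v) 0 0 (actProg.run (loadProg.run σ))) ∨
    (PairOk G H b u v ∧ Searching G b H (if (v : ℕ) + 1 < n then u else u + 1)
      (if (v : ℕ) + 1 < n then v + 1 else 0) (actProg.run (loadProg.run σ))) := by
  obtain ⟨hS, h16, h17, h18, h19, h20⟩ := h.load
  have hG := h.input.arr_ne_zero_iff u v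
  have hH := h.output.arr_ne_zero_iff u v
  rw [h.degree] at h18 h19
  rw [h.degree, h.degree] at h20
  rw [← h16] at hG
  rw [← h17] at hH
  generalize loadProg.run σ = ρ at *
  by_cases hHuv : H.Adj u v
  · have h1 : ρ.reg 17 ≠ 0 := hH.2 hHuv
    by_cases hs : b < vertexDegree H u + vertexDegree H v
    · refine Or.inl ⟨hHuv, hs, ?_⟩
      have hrun : actProg.run ρ = removeProg.run (ρ.setReg 21 (ρ.reg 20 - ρ.reg 9)) := by
        have : ρ.reg 20 - ρ.reg 9 ≠ 0 := by rw [h20, hS.bound]; omega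
        simp [actProg, Prog.run, h1, this]
      rw [hrun]
      exact (hS.setReg (Or.inr rfl)).remove hHuv (by simpa using h18) (by simpa using h19)
    · refine Or.inr (Or.inr ⟨⟨fun _ => not_lt.1 hs, fun _ h => absurd hHuv h⟩, ?_⟩)
      have hrun : actProg.run ρ = advanceProg.run (ρ.setReg 21 (ρ.reg 20 - ρ.reg 9)) := by
        have : ρ.reg 20 - ρ.reg 9 = 0 := by rw [h20, hS.bound]; omega
        simp [actProg, Prog.run, h1, this]
      rw [hrun]
      exact (hS.setReg (Or.inr rfl)).advance v.2
  · have h1 : ρ.reg 17 = 0 := by by_contra h; exact hHuv (hH.1 h)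
    by_cases hGuv : G.Adj u v
    · have h2 : ρ.reg 16 ≠ 0 := hG.2 hGuv
      by_cases hs : vertexDegree H u + vertexDegree H v + 1 < b
      · refine Or.inr (Or.inl ⟨hHuv, hGuv, hs, ?_⟩)
        have hrun : actProg.run ρ = insertProg.run ((ρ.setReg 21 (ρ.reg 20 + ρ.reg 8)).setReg 21
            (ρ.reg 9 - (ρ.reg 20 + ρ.reg 8))) := by
          have : ρ.reg 9 - (ρ.reg 20 + ρ.reg 8) ≠ 0 := by rw [h20, hS.bound, hS.one]; omega
          simp [actProg, Prog.run, h1, h2, this]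
        rw [hrun]
        exact ((hS.setReg (Or.inr rfl)).setReg (Or.inr rfl)).insert hGuv.ne hHuv
          (by simpa using h18) (by simpa using h19)
      · refine Or.inr (Or.inr ⟨⟨fun h => absurd h hHuv, fun _ _ => not_lt.1 hs⟩, ?_⟩)
        have hrun : actProg.run ρ = advanceProg.run ((ρ.setReg 21 (ρ.reg 20 + ρ.reg 8)).setReg 21
            (ρ.reg 9 - (ρ.reg 20 + ρ.reg 8))) := by
          have : ρ.reg 9 - (ρ.reg 20 + ρ.reg 8) = 0 := by rw [h20, hS.bound, hS.one]; omega
          simp [actProg, Prog.run, h1, h2, this]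
        rw [hrun]
        exact ((hS.setReg (Or.inr rfl)).setReg (Or.inr rfl)).advance v.2
    · have h2 : ρ.reg 16 = 0 := by by_contra h; exact hGuv (hG.1 h)
      refine Or.inr (Or.inr ⟨⟨fun h => absurd h hHuv, fun h => absurd h hGuv⟩, ?_⟩)
      have hrun : actProg.run ρ = advanceProg.run ρ := by
        simp [actProg, Prog.run, h1, h2]
      rw [hrun]
      exact hS.advance v.2

theorem searchBody_loopFree : searchBody.LoopFree := by
  simp [searchBody, loadProg, actProg, removeProg, insertProg, advanceProg, resetProg,
    Prog.LoopFree]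

/-- The invariant of the local search, with `k` an upper bound for the number of steps to go. -/
def SearchInvariant (G : SimpleGraph (Fin n)) (b k : ℕ) (σ : Mem) : Prop :=
  ∃ (H : SimpleGraph (Fin n)) (u v : ℕ), Searching G b H u v σ ∧ σ.reg 15 = n - u ∧ H ≤ G ∧
    (u < n → v < n) ∧ (∀ x y : Fin n, (x : ℕ) * n + y < u * n + v → PairOk G H b x y) ∧
    k = (4 * n ^ 3 - potential b H).toNat * (n * n + 1) + (n * n - (u * n + v))

theorem searchBody_decreases (hb : b ≤ 2 * n) (k : ℕ) (σ : Mem) (h : SearchInvariant G b k σ)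
    (hr : σ.reg 15 ≠ 0) : ∃ k' < k, SearchInvariant G b k' (searchBody.run σ) := by
  obtain ⟨H, u, v, hS, h15, hle, huv, hok, rfl⟩ := h
  have hu : u < n := by omega
  have hv := huv hu
  have hidx : u * n + v + 1 ≤ n * n := by
    have : (u + 1) * n ≤ n * n := Nat.mul_le_mul_right _ hu
    rw [add_mul] at this
    omega
  have hpot := potential_le hb H
  have hreset : ∀ H' : SimpleGraph (Fin n), potential b H + 2 ≤ potential b H' →
      (4 * n ^ 3 - potential b H').toNat * (n * n + 1) + (n * n - (0 * n + 0)) <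
        (4 * n ^ 3 - potential b H).toNat * (n * n + 1) + (n * n - (u * n + v)) := by
    intro H' hH'
    have hpot' := potential_le hb H'
    have h1 : (4 * n ^ 3 - potential b H').toNat + 1 ≤ (4 * n ^ 3 - potential b H).toNat := by
      omega
    have h2 := Nat.mul_le_mul_right (n * n + 1) h1
    rw [add_mul] at h2
    omega
  have hfin : ∀ {H' : SimpleGraph (Fin n)} {u' v' : ℕ},
      Searching G b H' u' v' (actProg.run (loadProg.run σ)) →
      Searching G b H' u' v' (searchBody.run σ) ∧ (searchBody.run σ).reg 15 = n - u' := by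
    intro H' u' v' h
    refine ⟨h.setReg (Or.inl rfl), ?_⟩
    simp [searchBody, Prog.run, h.size, h.row]
  have hzero : ∀ (H' : SimpleGraph (Fin n)) (x y : Fin n),
      (x : ℕ) * n + y < 0 * n + 0 → PairOk G H' b x y := fun H' x y h => by omega
  rcases Searching.act (u := ⟨u, hu⟩) (v := ⟨v, hv⟩) hS with ⟨hadj, hs, h⟩ | ⟨hadj, hG, hs, h⟩ |
    ⟨hgood, h⟩
  · refine ⟨_, hreset _ ?_, _, 0, 0, (hfin h).1, (hfin h).2,
      fun x y hxy => hle hxy.1, fun _ => by omega, hzero _, rfl⟩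
    have hne := hadj.ne
    have hdeg := vertexDegree_sup_edge hne (not_sdiff_edge_adj (H := H) hne)
    have hp := potential_sup_edge b hne (not_sdiff_edge_adj (H := H) hne)
    rw [sdiff_edge_sup_edge hadj] at hdeg hp
    have h1 := hdeg ⟨u, hu⟩
    have h2 := hdeg ⟨v, hv⟩
    simp only [true_or, or_true, if_true] at h1 h2
    omega
  · refine ⟨_, hreset _ ?_, _, 0, 0, (hfin h).1, (hfin h).2,
      sup_le hle ?_, fun _ => by omega, hzero _, rfl⟩
    · rw [potential_sup_edge b hG.ne hadj]
      omega
    · rw [SimpleGraph.edge_le_iff]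
      exact Or.inr hG
  · have hnext : (if v + 1 < n then u else u + 1) * n + (if v + 1 < n then v + 1 else 0) =
        u * n + v + 1 := by
      split_ifs with hvn
      · ring
      · have : v + 1 = n := by omega
        rw [add_mul]
        omega
    refine ⟨_, ?_, H, _, _, (hfin h).1, (hfin h).2, hle, ?_, ?_, rfl⟩
    · rw [hnext]
      omega
    · split_ifs <;> intro <;> omega
    · intro x y hxy
      rw [hnext] at hxy
      rcases Nat.lt_succ_iff_lt_or_eq.1 hxy with h' | h'
      · exact hok x y h'
      · obtain ⟨rfl, rfl⟩ := (index_inj (u := ⟨u, hu⟩) (v := ⟨v, hv⟩)).1 h'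
        exact hgood

/-- The algorithm: compute the degree bound, then search. -/
def edcsProg (K : ℕ) : Prog := .seq (boundProg K) searchProg

theorem inputMem_holdsGraph (G : SimpleGraph (Fin n)) (ε p : ℚ) :
    (inputMem G ε p).HoldsGraph 0 G := by
  intro u v
  constructor
  · intro h
    simp only [inputMem]
    rw [if_pos ⟨rfl, u, v, h, rfl⟩]
  · intro h
    simp only [inputMem]
    rw [if_neg]
    rintro ⟨-, x, y, hxy, he⟩
    obtain ⟨rfl, rfl⟩ := index_inj.1 he
    exact h hxy

theorem edcsProg_exec (K : ℕ) (G : SimpleGraph (Fin n)) {ε p : ℚ} (hε : 0 < ε) (hp : 0 < p) :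
    ∃ (H : SimpleGraph (Fin n)) (t : ℕ) (τ : Mem), Exec (edcsProg K) (inputMem G ε p) t τ ∧
      t ≤ 30 * (ε.den.size + p.den.size + 1) +
        ((4 * n ^ 3 * (n * n + 1) + n * n) * (searchBody.cost + 1) + 1) ∧
      τ.HoldsGraph 1 H ∧ IsEDCS G H (degreeBound K ε p) (degreeBound K ε p - 1) := by
  have hnum : ∀ {x : ℚ}, 0 < x → 0 < x.num.toNat := fun h => by
    have := Rat.num_pos.2 h
    omega
  obtain ⟨t, ρ, hexec, ht, harr, h0, h8, h9, h15, hz⟩ := boundProg_exec K (σ := inputMem G ε p)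
    (by simpa [inputMem] using hnum hε) (by simpa [inputMem] using hnum hp)
    (fun r hr => by
      simp only [inputMem]
      rw [List.getD_eq_default]
      simp only [List.length_cons, List.length_nil]
      omega)
  replace h0 : ρ.reg 0 = n := h0.trans (by simp [inputMem])
  replace h9 : ρ.reg 9 = min (degreeBound K ε p) (2 * n) := h9.trans (by
    simp [inputMem, degreeBound])
  replace h15 : ρ.reg 15 = n := h15.trans (by simp [inputMem])
  replace ht : t ≤ 30 * (ε.den.size + p.den.size + 1) := ht.trans (by simp [inputMem])
  have hempty : ∀ a i, a ≠ 0 → ρ.arr a i = 0 := by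
    intro a i ha
    rw [harr]
    simp [inputMem, ha]
  have hS : Searching G (min (degreeBound K ε p) (2 * n)) ⊥ 0 0 ρ := by
    refine ⟨h0, h8, h9, hz 22 (by omega) (by omega), hz 11 (by omega) (by omega),
      hz 12 (by omega) (by omega), ?_, ?_, ?_, ?_, ?_⟩
    · simpa using hz 13 (by omega) (by omega)
    · simpa using hz 14 (by omega) (by omega)
    · have := inputMem_holdsGraph G ε p
      unfold Mem.HoldsGraph at this ⊢
      rwa [harr]
    · intro u v
      simp [hempty]
    · intro w
      simp [hempty, vertexDegree, SimpleGraph.neighborSet]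
  obtain ⟨t', τ, k, hexec', ht', ⟨H, u, v, hS', h15', hle, -, hok, -⟩, hr⟩ :=
    Exec.while_measure searchBody_loopFree (r := 15)
      (I := SearchInvariant G (min (degreeBound K ε p) (2 * n)))
      (searchBody_decreases (min_le_right _ _)) _ ρ
      ⟨⊥, 0, 0, hS, by simpa using h15, bot_le, fun h => h, fun x y h => by omega, rfl⟩
  refine ⟨H, t + t', τ, .seq hexec hexec', ?_, hS'.output, isEDCS_of_pairOk hle ?_⟩
  · refine add_le_add ht (ht'.trans (le_of_eq ?_))
    have : ((4 : ℤ) * n ^ 3 - 0).toNat = 4 * n ^ 3 := by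
      rw [sub_zero]
      exact_mod_cast Int.toNat_natCast (4 * n ^ 3)
    rw [potential_bot, this]
    simp
  · intro x y
    apply hok
    have hu : n ≤ u := by omega
    have h1 : n * n ≤ u * n := Nat.mul_le_mul_right _ hu
    have h2 : ((x : ℕ) + 1) * n ≤ n * n := Nat.mul_le_mul_right _ x.2
    rw [add_mul] at h2
    have := y.2
    omega

theorem exists_polyTimeComputable_isEDCS (K : ℕ) :
    ∃ A : ∀ n : ℕ, SimpleGraph (Fin n) → ℚ → ℚ → SimpleGraph (Fin n), PolyTimeComputable A ∧
      ∀ (n : ℕ) (G : SimpleGraph (Fin n)) (ε p : ℚ), 0 < ε → 0 < p →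
        IsEDCS G (A n G ε p) (degreeBound K ε p) (degreeBound K ε p - 1) := by
  have hex : ∀ (n : ℕ) (G : SimpleGraph (Fin n)) (ε p : ℚ), ∃ H : SimpleGraph (Fin n),
      0 < ε → 0 < p → ∃ (t : ℕ) (τ : Mem), Exec (edcsProg K) (inputMem G ε p) t τ ∧
      t ≤ 30 * (ε.den.size + p.den.size + 1) +
        ((4 * n ^ 3 * (n * n + 1) + n * n) * (searchBody.cost + 1) + 1) ∧
      τ.HoldsGraph 1 H ∧ IsEDCS G H (degreeBound K ε p) (degreeBound K ε p - 1) := by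
    intro n G ε p
    by_cases h : 0 < ε ∧ 0 < p
    · obtain ⟨H, hH⟩ := edcsProg_exec K G h.1 h.2
      exact ⟨H, fun _ _ => hH⟩
    · exact ⟨⊥, fun h1 h2 => absurd ⟨h1, h2⟩ h⟩
  choose A hA using hex
  refine ⟨A, ⟨edcsProg K, 30 * (Polynomial.X + 1) + ((4 * Polynomial.X ^ 2 * (Polynomial.X + 1) +
    Polynomial.X) * Polynomial.C (searchBody.cost + 1) + 1), fun n G ε p hε hp => ?_⟩,
    fun n G ε p hε hp => ?_⟩
  · obtain ⟨t, τ, hexec, ht, hτ, -⟩ := hA n G ε p hε hp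
    refine ⟨t, τ, hexec, ht.trans ?_, hτ⟩
    simp only [Polynomial.eval_add, Polynomial.eval_mul, Polynomial.eval_X, Polynomial.eval_pow,
      Polynomial.eval_C, Polynomial.eval_one, Polynomial.eval_ofNat]
    have h1 : n * n ≤ inputSize n ε p := by unfold inputSize; rw [← sq]; omega
    have h2 : ε.den.size + p.den.size ≤ inputSize n ε p := by unfold inputSize; omega
    have h3 : n ^ 3 ≤ inputSize n ε p ^ 2 := by
      rcases Nat.eq_zero_or_pos n with rfl | hn
      · simp
      · calc n ^ 3 ≤ n ^ 4 := Nat.pow_le_pow_right hn (by norm_num)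
          _ = (n * n) ^ 2 := by ring
          _ ≤ _ := Nat.pow_le_pow_left h1 2
    gcongr
  · obtain ⟨t, τ, -, -, -, h⟩ := hA n G ε p hε hp
    exact h

end RAM

/-! ### The size of the degree bound -/

theorem doublings_rat {x : ℚ} (hx : 0 < x) (hx1 : (x : ℝ) ≤ 1) :
    1 ≤ (x : ℝ) * 2 ^ RAM.doublings x.num.toNat x.den ∧
      (x : ℝ) * 2 ^ RAM.doublings x.num.toNat x.den ≤ 2 := by
  have hnum := Rat.num_pos.2 hx
  have hd : (0 : ℝ) < x.den := by exact_mod_cast x.den_pos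
  have hcast : ((x.num.toNat : ℕ) : ℝ) = x.num := by
    have : ((x.num.toNat : ℕ) : ℤ) = x.num := Int.toNat_of_nonneg hnum.le
    exact_mod_cast this
  have hxe : (x : ℝ) = x.num.toNat / x.den := by
    rw [hcast]
    exact_mod_cast (Rat.num_div_den x).symm
  set a := RAM.doublings x.num.toNat x.den with ha
  constructor
  · have h := RAM.le_mul_two_pow_doublings (x := x.num.toNat) (by omega) x.den
    rw [← ha] at h
    have h' : (x.den : ℝ) ≤ x.num.toNat * 2 ^ a := by exact_mod_cast h
    rw [hxe, div_mul_eq_mul_div, le_div_iff₀ hd]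
    linarith
  · rcases Nat.eq_zero_or_pos a with h0 | hpos
    · rw [h0]
      linarith
    · have h := RAM.mul_two_pow_lt_of_lt_doublings (x := x.num.toNat) (y := x.den)
        (j := a - 1) (by omega)
      have h' : (x.num.toNat : ℝ) * 2 ^ (a - 1) ≤ x.den := by exact_mod_cast h.le
      have h2 : (2 : ℝ) ^ a = 2 * 2 ^ (a - 1) := by
        rw [← pow_succ', Nat.sub_add_cancel hpos]
      rw [hxe, div_mul_eq_mul_div, div_le_iff₀ hd, h2]
      linarith

section

variable {ε : ℝ} {p : unitInterval} {ε₀ p₀ : ℚ}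

/-- The degree bound has the form `K * l * α ^ 2 * π` with `α ≈ 1 / ε`, `π ≈ 1 / p` and
`2 ^ l = α * π`. -/
theorem degreeBound_shape (K : ℕ) (hε : 0 < ε) (hε' : ε < 1 / 4) (hp : 0 < (p : ℝ))
    (h1 : ε / 2 ≤ ε₀) (h2 : (ε₀ : ℝ) ≤ ε) (h3 : (p : ℝ) / 2 ≤ p₀) (h4 : (p₀ : ℝ) ≤ p) :
    ∃ (l : ℕ) (α π : ℝ), (RAM.degreeBound K ε₀ p₀ : ℝ) = K * l * α ^ 2 * π ∧
      α * π = 2 ^ l ∧ 1 ≤ ε * α ∧ ε * α ≤ 4 ∧ 1 ≤ p * π ∧ p * π ≤ 4 ∧ 8 ≤ α ∧ 1 ≤ π := by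
  have hp' : (p : ℝ) ≤ 1 := p.2.2
  have hε0 : 0 < ε₀ := by
    have : (0 : ℝ) < ε₀ := by linarith
    exact_mod_cast this
  have hp0 : 0 < p₀ := by
    have : (0 : ℝ) < p₀ := by linarith
    exact_mod_cast this
  obtain ⟨e1, e2⟩ := doublings_rat hε0 (by linarith)
  obtain ⟨q1, q2⟩ := doublings_rat hp0 (by linarith)
  set a := RAM.doublings ε₀.num.toNat ε₀.den with ha
  set b := RAM.doublings p₀.num.toNat p₀.den with hb
  have hα : (0 : ℝ) < 2 ^ a := by positivity
  have hπ : (0 : ℝ) < 2 ^ b := by positivity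
  have hεα : 1 ≤ ε * 2 ^ a := e1.trans (mul_le_mul_of_nonneg_right h2 hα.le)
  refine ⟨a + b, 2 ^ a, 2 ^ b, ?_, (pow_add _ _ _).symm, hεα, ?_, ?_, ?_, ?_, ?_⟩
  · rw [RAM.degreeBound, ← ha, ← hb]
    push_cast
    rw [show (4 : ℝ) = 2 ^ 2 by norm_num, ← pow_mul, ← pow_mul, mul_comm 2 a]
    ring
  · have := mul_le_mul_of_nonneg_right h1 hα.le
    linarith
  · exact q1.trans (mul_le_mul_of_nonneg_right h4 hπ.le)
  · have := mul_le_mul_of_nonneg_right h3 hπ.le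
    linarith
  · have h5 : (4 : ℝ) < 2 ^ a := by nlinarith
    have h6 : 2 ^ 2 < 2 ^ a := by exact_mod_cast (by linarith : ((2 : ℝ) ^ 2) < 2 ^ a)
    have h7 : 2 < a := (Nat.pow_lt_pow_iff_right (by norm_num)).1 h6
    calc (8 : ℝ) = 2 ^ 3 := by norm_num
      _ ≤ 2 ^ a := pow_le_pow_right₀ (by norm_num) h7
  · exact one_le_pow₀ (by norm_num)

theorem degreeBound_log_bounds {l : ℕ} {α π q : ℝ} (hε : 0 < ε) (hε' : ε < 1 / 4) (hq : 0 < q)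
    (hq' : q ≤ 1) (hl : α * π = 2 ^ l) (h1 : 1 ≤ ε * α) (h2 : ε * α ≤ 4) (h3 : 1 ≤ q * π)
    (h4 : q * π ≤ 4) :
    Real.log (1 / (ε * q)) ≤ l ∧ l ≤ 5 * Real.log (1 / (ε * q)) := by
  have hα : 0 < α := by
    by_contra h
    nlinarith
  have hπ : 0 < π := by
    by_contra h
    nlinarith
  have hlog : (l : ℝ) * Real.log 2 = Real.log (α * π) := by rw [hl, Real.log_pow]
  have hsum : Real.log (α * π) = Real.log (1 / (ε * q)) + Real.log ((ε * α) * (q * π)) := by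
    rw [← Real.log_mul (by positivity) (by positivity)]
    congr 1
    field_simp
  have hlow : 0 ≤ Real.log ((ε * α) * (q * π)) := Real.log_nonneg (by nlinarith)
  have hup : Real.log ((ε * α) * (q * π)) ≤ Real.log (2 ^ 4) :=
    Real.log_le_log (by positivity) (by nlinarith)
  have hbase : Real.log (2 ^ 2) ≤ Real.log (1 / (ε * q)) := by
    apply Real.log_le_log (by norm_num)
    rw [le_div_iff₀ (by positivity)]
    nlinarith
  rw [Real.log_pow] at hup hbase
  push_cast at hup hbase
  have hlog2 := Real.log_two_gt_d9
  have hlog2' := Real.log_two_lt_d9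
  have hl0 : (0 : ℝ) ≤ l := by positivity
  constructor <;> nlinarith

theorem degreeBound_tail {l β : ℕ} {α π q : ℝ} (hε : 0 < ε) (hq : 0 < q)
    (hβ : (β : ℝ) = (2 ^ 21 : ℕ) * l * α ^ 2 * π) (hl : α * π = 2 ^ l) (h1 : 1 ≤ ε * α)
    (h3 : 1 ≤ q * π) (hα : 8 ≤ α) (hπ : 1 ≤ π) :
    1 ≤ (ε / 128) ^ 2 * (q * β) ∧
      4 * (1 + β : ℝ) ^ 2 * Real.exp (-((ε / 128) ^ 2 * β * q / 4)) ≤ ε / 128 * q := by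
  set X : ℝ := 2 ^ l with hX
  have hX8 : 8 ≤ X := by rw [← hl]; nlinarith
  have hl1 : (1 : ℝ) ≤ l := by
    rcases Nat.eq_zero_or_pos l with h | h
    · rw [hX, h] at hX8
      norm_num at hX8
    · exact_mod_cast h
  have hlX : (l : ℝ) ≤ X := by
    rw [hX]
    exact_mod_cast Nat.lt_two_pow_self.le
  have hmain : 128 * (l : ℝ) ≤ (ε / 128) ^ 2 * (q * β) := by
    have e : (ε / 128) ^ 2 * (q * β) = 128 * l * ((ε * α) ^ 2 * (q * π)) := by
      rw [hβ]
      push_cast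
      ring
    rw [e]
    have : 1 ≤ (ε * α) ^ 2 * (q * π) := one_le_mul_of_one_le_of_one_le (one_le_pow₀ h1) h3
    nlinarith
  refine ⟨by linarith, ?_⟩
  have hexp : Real.exp (-((ε / 128) ^ 2 * β * q / 4)) * X ^ 32 ≤ 1 := by
    have hXe : X ≤ Real.exp l := by
      rw [hX, ← mul_one (l : ℝ), Real.exp_nat_mul]
      exact pow_le_pow_left₀ (by norm_num) (by linarith [Real.add_one_le_exp 1]) _
    have h32 : X ^ 32 ≤ Real.exp (32 * l) := by
      have := pow_le_pow_left₀ (by linarith) hXe 32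
      rwa [← Real.exp_nat_mul] at this
    calc Real.exp (-((ε / 128) ^ 2 * β * q / 4)) * X ^ 32
        ≤ Real.exp (-((ε / 128) ^ 2 * β * q / 4)) * Real.exp (32 * l) := by gcongr
      _ = Real.exp (-((ε / 128) ^ 2 * β * q / 4) + 32 * l) := (Real.exp_add _ _).symm
      _ ≤ 1 := Real.exp_le_one_iff.2 (by linarith)
  set y := Real.exp (-((ε / 128) ^ 2 * β * q / 4)) with hy
  have hy0 : 0 < y := Real.exp_pos _
  have hβX : (β : ℝ) ≤ 2 ^ 21 * X ^ 3 := by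
    have e : α ^ 2 * π ≤ X ^ 2 := by
      rw [← hl, mul_pow]
      exact mul_le_mul_of_nonneg_left (by nlinarith) (sq_nonneg α)
    calc (β : ℝ) = 2 ^ 21 * l * (α ^ 2 * π) := by rw [hβ]; push_cast; ring
      _ ≤ 2 ^ 21 * X * X ^ 2 := by gcongr
      _ = 2 ^ 21 * X ^ 3 := by ring
  have h1β : 1 + (β : ℝ) ≤ 2 ^ 22 * X ^ 3 := by
    have : 1 ≤ X ^ 3 := one_le_pow₀ (by linarith)
    linarith
  have hεq : 1 ≤ ε * q * X := by
    rw [← hl]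
    nlinarith
  have hX25 : (2 : ℝ) ^ 53 ≤ X ^ 25 := by
    calc (2 : ℝ) ^ 53 ≤ 8 ^ 25 := by norm_num
      _ ≤ X ^ 25 := pow_le_pow_left₀ (by norm_num) hX8 _
  have hX0 : 0 < X := by linarith
  have hsq : (1 + β : ℝ) ^ 2 ≤ (2 ^ 22 * X ^ 3) ^ 2 := pow_le_pow_left₀ (by positivity) h1β 2
  have hfin : 4 * (1 + β : ℝ) ^ 2 * y * (128 * X) ≤ 1 := by
    calc 4 * (1 + β : ℝ) ^ 2 * y * (128 * X)
        ≤ 4 * (2 ^ 22 * X ^ 3) ^ 2 * y * (128 * X) := by gcongr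
      _ = 2 ^ 53 * (y * X ^ 7) := by ring
      _ ≤ X ^ 25 * (y * X ^ 7) := by gcongr
      _ = y * X ^ 32 := by ring
      _ ≤ 1 := hexp
  have : 4 * (1 + β : ℝ) ^ 2 * y * (128 * X) ≤ ε / 128 * q * (128 * X) := by linarith
  exact le_of_mul_le_mul_right this (by positivity)

end

theorem mainTheorem4 :
    ∃ (c C : ℝ) (β : ℚ → ℚ → ℕ)
      (A : ∀ n : ℕ, SimpleGraph (Fin n) → ℚ → ℚ → SimpleGraph (Fin n)),
      0 < c ∧ 0 < C ∧ RAM.PolyTimeComputable A ∧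
      ∀ (ε : ℝ) (p : unitInterval) (ε₀ p₀ : ℚ),
        0 < ε → ε < 1 / 4 → 0 < (p : ℝ) →
        ε / 2 ≤ ε₀ → (ε₀ : ℝ) ≤ ε → (p : ℝ) / 2 ≤ p₀ → (p₀ : ℝ) ≤ p →
        c * (Real.log (1 / (ε * p)) / (ε ^ 2 * p)) ≤ β ε₀ p₀ ∧
        (β ε₀ p₀ : ℝ) ≤ C * (Real.log (1 / (ε * p)) / (ε ^ 2 * p)) ∧
        ∀ (n : ℕ) (G : SimpleGraph (Fin n)),
          IsEDCS G (A n G ε₀ p₀) (β ε₀ p₀) (β ε₀ p₀ - 1) ∧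
          (∀ v, (vertexDegree (A n G ε₀ p₀) v : ℝ) ≤
            C * (Real.log (1 / (ε * p)) / (ε ^ 2 * p))) ∧
          expectedMatching G G p ≤ (3 / 2 + ε) * expectedMatching G (A n G ε₀ p₀) p := by
  obtain ⟨A, hA, hEDCS⟩ := RAM.exists_polyTimeComputable_isEDCS (2 ^ 21)
  refine ⟨2 ^ 21, 320 * 2 ^ 21, RAM.degreeBound (2 ^ 21), A, by norm_num, by norm_num, hA, ?_⟩
  intro ε p ε₀ p₀ hε hε' hp h1 h2 h3 h4
  have hp' : (p : ℝ) ≤ 1 := p.2.2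
  have hε0 : 0 < ε₀ := by
    have : (0 : ℝ) < ε₀ := by linarith
    exact_mod_cast this
  have hp0 : 0 < p₀ := by
    have : (0 : ℝ) < p₀ := by linarith
    exact_mod_cast this
  obtain ⟨l, α, π, hβ, hl, e1, e2, q1, q2, hα, hπ⟩ :=
    degreeBound_shape (2 ^ 21) hε hε' hp h1 h2 h3 h4
  obtain ⟨hlog, hlog'⟩ := degreeBound_log_bounds hε hε' hp hp' hl e1 e2 q1 q2
  have hβe : (RAM.degreeBound (2 ^ 21) ε₀ p₀ : ℝ) * (ε ^ 2 * p) =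
      2 ^ 21 * l * ((ε * α) ^ 2 * (p * π)) := by
    rw [hβ]
    push_cast
    ring
  have hl0 : (0 : ℝ) ≤ l := by positivity
  have hlow : 1 ≤ (ε * α) ^ 2 * (p * π) := one_le_mul_of_one_le_of_one_le (one_le_pow₀ e1) q1
  have hupp : (ε * α) ^ 2 * (p * π) ≤ 4 ^ 2 * 4 := by gcongr
  have hden : 0 < ε ^ 2 * (p : ℝ) := by positivity
  have hupper : (RAM.degreeBound (2 ^ 21) ε₀ p₀ : ℝ) ≤
      320 * 2 ^ 21 * (Real.log (1 / (ε * p)) / (ε ^ 2 * p)) := by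
    rw [← mul_div_assoc, le_div_iff₀ hden, hβe]
    have : 2 ^ 21 * (l : ℝ) * ((ε * α) ^ 2 * (p * π)) ≤ 2 ^ 21 * l * (4 ^ 2 * 4) := by gcongr
    linarith
  refine ⟨?_, hupper, fun n G => ?_⟩
  · rw [← mul_div_assoc, div_le_iff₀ hden, hβe]
    have : 2 ^ 21 * (l : ℝ) * 1 ≤ 2 ^ 21 * l * ((ε * α) ^ 2 * (p * π)) := by gcongr
    linarith
  · have hH := hEDCS n G ε₀ p₀ hε0 hp0
    refine ⟨hH, fun v => ?_, ?_⟩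
    · refine le_trans ?_ hupper
      exact_mod_cast hH.vertexDegree_le v
    · obtain ⟨ht1, ht2⟩ := degreeBound_tail hε hp hβ hl e1 q1 hα hπ
      have hmain := expectedMatching_le_of_isEDCS hH hp (lam := ε / 128) (by positivity)
        (by linarith) ht1 ht2
      refine hmain.trans (mul_le_mul_of_nonneg_right (by linarith) ?_)
      exact MeasureTheory.integral_nonneg fun _ => by positivity
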